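/- **Genus-modified Feynman theorem.** Let $V$ be a real vector space of dimension $d$ with a basis $b_1,\dots,b_d$, let $dx$ be the Lebesgue measure in the coordinates of this basis, and let $B$ be a symmetric positive-definite bilinear form on $V$; $\det B$ denotes the determinant of the matrix $(B(b_i,b_j))_{i,j}$, and $B^{-1}$ the form on $V^\vee$ whose matrix in the dual basis is the inverse matrix. For $g,m\ge 0$ let $B_{g,m}$ be an $m$-multilinear form on $V$, with $B_{0,0}=B_{0,1}=B_{0,2}=0$, and put $$S(x)=\tfrac12B(x,x)+\sum_{g,m\ge0}\frac{\hbar^g}{m!}B_{g,m}(x,\dots,x).$$ Let $Z=\hbar^{-d/2}\int_V e^{-S(x)/\hbar}\,dx$, understood as a formal power series in $\hbar^{1/2}$ with real coefficients: with $x=\hbar^{1/2}y$ one has $\hbar^{-d/2}dx=dy$, the expression $-S(\hbar^{1/2}y)/\hbar$ is a formal power series in $\hbar^{1/2}$ for each $y\in V$, and the coefficients of its exponential are integrated over $y\in V$ one by one. Then all these integrals converge absolutely, and $$Z=\frac{(2\pi)^{d/2}}{\sqrt{\det B}}\sum_{\mathbf n=(n_0,n_1,\dots)}\ \sum_{\Gamma\in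 G'(\mathbf n)}\frac{\hbar^{-\chi_\Gamma}}{|\mathrm{Aut}(\Gamma)|}F_\Gamma ,$$ where for each power of $\hbar^{1/2}$ the coefficients of the right-hand side form an unconditionally convergent series of real numbers over all pairs $(\mathbf n,\Gamma)$. Here $\mathbf n$ runs through the sequences of nonnegative integers with almost all terms zero, and $G'(\mathbf n)$ is the set of isomorphism classes of finite graphs with exactly $n_i$ vertices of valence $i$ for each $i$, in which each vertex $v$ is labelled by a genus $g(v)\in\mathbb Z_{\ge0}$. Graphs may be empty or disconnected and may have self-edges and multiple edges; a graph is given by its vertices, its half-edges, the vertex to which each half-edge is attached, and the pairing of the half-edges into edges, so that a self-edge contributes $2$ to the valence. Isomorphisms, and the automorphisms forming $\mathrm{Aut}(\Gamma)$, are pairs of bijections of the vertices and of the half-edges that preserve attachment, pairing and genera. The Euler characteristic is $$\chi_\Gamma=-\sum_{v\in V(\Gamma)}g(v)+|V(\Gamma)|-|E(\Gamma)| .$$ The amplitude $F_\Gamma$ is the real number obtained by putting the $m$-tensor $-B_{g,m}$ (symmetrized, if $B_{g,m}$ is not symmetric) at each $m$-valent vertex of genus $g$ and contracting, along each edge, the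 tensors at its two ends with $B^{-1}$; the amplitude of the empty graph is $1$. -/

import Mathlib

open scoped PowerSeries

noncomputable section

namespace Feynman

/-! ### Genus-labelled graphs

A graph is a finite set of vertices and a finite set of half-edges; every half-edge is attached to
a vertex, and a fixed-point free involution glues the half-edges in pairs to form the edges.
Self-edges, multiple edges, isolated vertices, disconnected graphs and the empty graph are allowed.
Up to isomorphism the two finite sets may be taken to be `Fin nV` and `Fin nH`. -/

/-- A finite graph whose vertices are labelled by a genus. -/
structure GenusGraph where
  /-- number of vertices -/
  nV : ℕ
  /-- number of half-edges -/
  nH : ℕ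
  /-- the vertex at which a half-edge is attached -/
  root : Fin nH → Fin nV
  /-- the other half of the edge to which a half-edge belongs -/
  opp : Fin nH → Fin nH
  opp_opp : ∀ h, opp (opp h) = h
  opp_ne : ∀ h, opp h ≠ h
  /-- the genus of a vertex -/
  genus : Fin nV → ℕ

namespace GenusGraph

/-- The set of half-edges attached to the vertex `v`. -/
abbrev HalfEdgesAt (Γ : GenusGraph) (v : Fin Γ.nV) : Type := {h : Fin Γ.nH // Γ.root h = v}

/-- The valence of a vertex: the number of half-edges attached to it (a self-edge counts twice). -/
def valence (Γ : GenusGraph) (v : Fin Γ.nV) : ℕ := Fintype.card (Γ.HalfEdgesAt v)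

/-- The edges `{h, opp h}`, each represented by the smaller of its two half-edges. -/
def edges (Γ : GenusGraph) : Finset (Fin Γ.nH) := Finset.univ.filter fun h => h < Γ.opp h

/-- The Euler characteristic `- ∑ g(v) + |V| - |E|`. -/
def eulerChar (Γ : GenusGraph) : ℤ :=
  -(∑ v, (Γ.genus v : ℤ)) + (Γ.nV : ℤ) - (Γ.edges.card : ℤ)

/-- The number of vertices of valence `i`. -/
def numValence (Γ : GenusGraph) (i : ℕ) : ℕ :=
  (Finset.univ.filter fun v => Γ.valence v = i).card

/-- Isomorphisms of genus-labelled graphs: bijections of the vertices and of the half-edges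
that respect attachment, edges and genera. -/
def Iso (Γ Δ : GenusGraph) : Type :=
  {f : (Fin Γ.nV ≃ Fin Δ.nV) × (Fin Γ.nH ≃ Fin Δ.nH) //
    (∀ h, Δ.root (f.2 h) = f.1 (Γ.root h)) ∧
    (∀ h, Δ.opp (f.2 h) = f.2 (Γ.opp h)) ∧
    (∀ v, Δ.genus (f.1 v) = Γ.genus v)}

instance (Γ Δ : GenusGraph) : Finite (Iso Γ Δ) := by
  unfold Iso; infer_instance

/-- The automorphisms of a genus-labelled graph. -/
abbrev Aut (Γ : GenusGraph) : Type := Iso Γ Γ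

/-- Being isomorphic is an equivalence relation. -/
instance isoSetoid : Setoid GenusGraph where
  r Γ Δ := Nonempty (Iso Γ Δ)
  iseqv := by
    refine ⟨fun Γ => ⟨⟨(Equiv.refl _, Equiv.refl _), by simp⟩⟩, ?_, ?_⟩
    · rintro Γ Δ ⟨⟨⟨p, q⟩, h1, h2, h3⟩⟩
      refine ⟨⟨(p.symm, q.symm), fun h => ?_, fun h => ?_, fun v => ?_⟩⟩
      · have := h1 (q.symm h)
        simp only [Equiv.apply_symm_apply] at this
        simp [this]
      · have := h2 (q.symm h)
        simp only [Equiv.apply_symm_apply] at this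
        simp [this]
      · have := h3 (p.symm v)
        simp only [Equiv.apply_symm_apply] at this
        simp [this]
    · rintro Γ Δ Θ ⟨⟨⟨p, q⟩, h1, h2, h3⟩⟩ ⟨⟨⟨p', q'⟩, h1', h2', h3'⟩⟩
      refine ⟨⟨(p.trans p', q.trans q'), fun h => ?_, fun h => ?_, fun v => ?_⟩⟩
      · simp only [Equiv.trans_apply] at *
        rw [h1', h1]
      · simp only [Equiv.trans_apply] at *
        rw [h2', h2]
      · simp only [Equiv.trans_apply] at *
        rw [h3', h3]

end GenusGraph

/-- Isomorphism classes of genus-labelled graphs. -/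
def GraphClass : Type := Quotient GenusGraph.isoSetoid

/-- A graph in the given isomorphism class. -/
def GraphClass.rep (c : GraphClass) : GenusGraph := Quotient.out c

/-- The set `G'(n)` of isomorphism classes of genus-labelled graphs that have `n i` vertices of
valence `i` for each `i`. -/
def GraphsWithValences (n : ℕ →₀ ℕ) : Type :=
  {c : GraphClass // ∀ i, c.rep.numValence i = n i}

/-! ### Feynman amplitudes -/

section Amplitude

variable {d : ℕ} {V : Type*} [AddCommGroup V] [Module ℝ V]

/-- The matrix of the bilinear form `B` in the basis `b`. -/
def gram (b : Module.Basis (Fin d) ℝ V) (B : LinearMap.BilinForm ℝ V) :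
    Matrix (Fin d) (Fin d) ℝ :=
  Matrix.of fun i j => B (b i) (b j)

/-- The number obtained by inserting the vectors `x h`, for `h` running through the half-edges
at `v`, into the `m`-tensor `-B_{g,m}`, where `g` and `m` are the genus and the valence of `v`.
The half-edges at `v` carry no order, so the average over all `m!` ways to match them with the
arguments of `B_{g,m}` is taken; if `B_{g,m}` is symmetric, all these ways give the same number
(see `vertexValue_eq`). -/
def vertexValue (C : ∀ _g m : ℕ, MultilinearMap ℝ (fun _ : Fin m => V) ℝ)
    (Γ : GenusGraph) (v : Fin Γ.nV) (x : Fin Γ.nH → V) : ℝ :=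
  (((Γ.valence v).factorial : ℝ))⁻¹ *
    ∑ e : Fin (Γ.valence v) ≃ Γ.HalfEdgesAt v,
      -(C (Γ.genus v) (Γ.valence v) fun j => x (e j).1)

/-- For a symmetric tensor the average in `vertexValue` may be replaced by any of its terms. -/
theorem vertexValue_eq (C : ∀ _g m : ℕ, MultilinearMap ℝ (fun _ : Fin m => V) ℝ)
    (hC : ∀ g m (τ : Equiv.Perm (Fin m)) (y : Fin m → V), C g m (fun j => y (τ j)) = C g m y)
    (Γ : GenusGraph) (v : Fin Γ.nV) (x : Fin Γ.nH → V)
    (e : Fin (Γ.valence v) ≃ Γ.HalfEdgesAt v) :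
    vertexValue C Γ v x = -(C (Γ.genus v) (Γ.valence v) fun j => x (e j).1) := by
  have key : ∀ e' : Fin (Γ.valence v) ≃ Γ.HalfEdgesAt v,
      C (Γ.genus v) (Γ.valence v) (fun j => x (e' j).1)
        = C (Γ.genus v) (Γ.valence v) fun j => x (e j).1 := by
    intro e'
    have := hC (Γ.genus v) (Γ.valence v) (e'.trans e.symm) (fun j => x (e j).1)
    simpa using this
  have hcard : Fintype.card (Fin (Γ.valence v) ≃ Γ.HalfEdgesAt v)
      = (Γ.valence v).factorial := by
    rw [Fintype.card_equiv e, Fintype.card_fin]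
  have hne : ((Γ.valence v).factorial : ℝ) ≠ 0 := by positivity
  unfold vertexValue
  rw [Finset.sum_congr rfl fun e' _ => by rw [key e'], Finset.sum_const, Finset.card_univ, hcard,
    nsmul_eq_mul, inv_mul_cancel_left₀ hne]

/-- The genus-modified Feynman amplitude: the tensor `-B_{g,m}` is put at each `m`-valent vertex
of genus `g`, and along each edge the two tensors are contracted with the form `B⁻¹` on the dual
space. In the basis `b` (with dual basis `b*`, in which `B⁻¹` has the matrix inverse to that of
`B`) this is a sum over all labellings of the half-edges by basis vectors. -/
def amplitude (b : Module.Basis (Fin d) ℝ V) (B : LinearMap.BilinForm ℝ V)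
    (C : ∀ _g m : ℕ, MultilinearMap ℝ (fun _ : Fin m => V) ℝ) (Γ : GenusGraph) : ℝ :=
  ∑ l : Fin Γ.nH → Fin d,
    (∏ v, vertexValue C Γ v fun h => b (l h)) *
      ∏ h ∈ Γ.edges, (gram b B)⁻¹ (l h) (l (Γ.opp h))

/-- The contribution `ħ^{-χ_Γ} F_Γ / |Aut Γ|` of a graph, as a Laurent series in `ħ^{1/2}`. -/
def graphTerm (b : Module.Basis (Fin d) ℝ V) (B : LinearMap.BilinForm ℝ V)
    (C : ∀ _g m : ℕ, MultilinearMap ℝ (fun _ : Fin m => V) ℝ) (Γ : GenusGraph) :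
    LaurentSeries ℝ :=
  HahnSeries.single (2 * -Γ.eulerChar) (amplitude b B C Γ / (Nat.card Γ.Aut : ℝ))

/-! ### The formal integral -/

/-- For `y` in `V`, the formal power series `S(ħ^{1/2} y)` in the variable `ħ^{1/2}`, where
`S(x) = B(x,x)/2 + ∑ ħ^g B_{g,m}(x,…,x)/m!`. -/
def actionSeries (B : LinearMap.BilinForm ℝ V)
    (C : ∀ _g m : ℕ, MultilinearMap ℝ (fun _ : Fin m => V) ℝ) (y : V) : ℝ⟦X⟧ :=
  PowerSeries.monomial 2 (B y y / 2) +
    PowerSeries.mk fun k =>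
      ∑ p ∈ (Finset.range (k + 1) ×ˢ Finset.range (k + 1)).filter (fun p => 2 * p.1 + p.2 = k),
        C p.1 p.2 (fun _ => y) / (p.2.factorial : ℝ)

/-- `-S(ħ^{1/2} y)/ħ` as a formal power series in `ħ^{1/2}`. (If `B_{0,0} = 0` and `B_{0,1} = 0`,
then `S(ħ^{1/2} y)` is divisible by `ħ`, and this is the quotient.) -/
def exponentSeries (B : LinearMap.BilinForm ℝ V)
    (C : ∀ _g m : ℕ, MultilinearMap ℝ (fun _ : Fin m => V) ℝ) (y : V) : ℝ⟦X⟧ :=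
  PowerSeries.mk fun k => -PowerSeries.coeff (k + 2) (actionSeries B C y)

/-- The exponential of a formal power series with real coefficients: `exp (a₀ + A) = e^{a₀} exp A`
if `A` has no constant term. -/
def formalExp (A : ℝ⟦X⟧) : ℝ⟦X⟧ :=
  PowerSeries.C (Real.exp (PowerSeries.constantCoeff A)) *
    (PowerSeries.exp ℝ).subst (A - PowerSeries.C (PowerSeries.constantCoeff A))

/-- The point of `V` with coordinates `c` in the basis `b`. -/
def point (b : Module.Basis (Fin d) ℝ V) (c : Fin d → ℝ) : V := ∑ i, c i • b i

/-- The formal integral `ħ^{-d/2} ∫ e^{-S(x)/ħ} dx` as a formal power series in `ħ^{1/2}`: after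
the substitution `x = ħ^{1/2} y`, which turns `ħ^{-d/2} dx` into `dy`, the formal power series
`e^{-S(ħ^{1/2} y)/ħ}` is integrated coefficient by coefficient over `V`, with respect to the
Lebesgue measure in the coordinates of the basis `b`. -/
def formalIntegral (b : Module.Basis (Fin d) ℝ V) (B : LinearMap.BilinForm ℝ V)
    (C : ∀ _g m : ℕ, MultilinearMap ℝ (fun _ : Fin m => V) ℝ) : ℝ⟦X⟧ :=
  PowerSeries.mk fun k =>
    ∫ c : Fin d → ℝ, PowerSeries.coeff k (formalExp (exponentSeries B C (point b c)))

end Amplitude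

end Feynman

end

noncomputable section

namespace Feynman

/-! ### Gaussian moments -/

open MeasureTheory

/-! Fix a power of ħ^{1/2}. Since B_{0,0} and B_{0,1} vanish, -S(ħ^{1/2}y)/ħ = -B(y,y)/2 + R(y),
where R is a power series in ħ^{1/2} with polynomial coefficients; since B_{0,2} vanishes, its
constant term is the number a = -B_{1,0}. Each coefficient of the integrand is thus a polynomial
times a Gaussian (`coeff_integrand`), and the integral is the sum over N of the Gaussian integral of
the relevant coefficient of R^N/N! (`hasSum_coeff_reducedInteraction`).

The N-th term counts graphs with N numbered vertices. Expanding R^N chooses a genus and a valence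
for each vertex. The factors 1/m_v! combine with multinomial coefficients into a sum over
attachments of M numbered half-edges, divided by M! (`sum_attachments`). Wick's theorem
(`gaussE_prod_X`) turns the Gaussian integral into a sum over gluings of the half-edges. So R^N/N!
gives every labelled graph with weight 1/(N! M!) (`hasSum_graphData`). By orbit-stabilizer an
isomorphism class has N! M!/|Aut| labellings, whence the weight 1/|Aut| (`hasSum_graphClass`).

Convergence is a real issue: an isolated vertex of genus 1 does not change the power of ħ, so
infinitely many graphs share one power. A contributing graph has a bounded number of half-edges, so
the number of graphs with N vertices and their amplitudes grow at most exponentially in N, and 1/N!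
wins (`summable_contribution`). Absolute summability then justifies both groupings of the sum over
labelled graphs: by N and by isomorphism class. -/

theorem integrable_pow_mul_exp_neg_sq_div_two (n : ℕ) :
    Integrable fun x : ℝ => x ^ n * Real.exp (-x ^ 2 / 2) := by
  have h := integrable_rpow_mul_exp_neg_mul_sq (b := 1 / 2) (by norm_num) (s := (n : ℝ))
    (by have : (0 : ℝ) ≤ n := n.cast_nonneg
        linarith)
  refine h.congr (Filter.Eventually.of_forall fun x => ?_)
  simp only [Real.rpow_natCast]
  congr 2
  ring

/-- The moments of the Gaussian weight `exp (-x²/2)` on the line. -/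
def gaussMoment (n : ℕ) : ℝ := ∫ x : ℝ, x ^ n * Real.exp (-x ^ 2 / 2)

theorem gaussMoment_zero : gaussMoment 0 = Real.sqrt (2 * Real.pi) := by
  have h := integral_gaussian (1 / 2)
  rw [gaussMoment]
  convert h using 2
  · ext x
    rw [pow_zero, one_mul]
    congr 1
    ring
  · ring

/-- Integration by parts with x exp(-x²/2) as the derivative of -exp(-x²/2). At n = 0 the truncated
index is harmless because its coefficient is zero. -/
theorem gaussMoment_succ (n : ℕ) : gaussMoment (n + 1) = n * gaussMoment (n - 1) := by
  have hv : ∀ x : ℝ, HasDerivAt (fun x : ℝ => -Real.exp (-x ^ 2 / 2))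
      (x * Real.exp (-x ^ 2 / 2)) x := by
    intro x
    have h1 : HasDerivAt (fun x : ℝ => -x ^ 2 / 2) (-x) x := by
      have := ((hasDerivAt_pow 2 x).neg).div_const 2
      refine this.congr_deriv ?_
      norm_num
      ring
    refine h1.exp.neg.congr_deriv ?_
    ring
  have hu : ∀ x : ℝ, HasDerivAt (fun x : ℝ => x ^ n) (n * x ^ (n - 1)) x :=
    fun x => hasDerivAt_pow n x
  have key := integral_mul_deriv_eq_deriv_mul_of_integrable (u := fun x : ℝ => x ^ n)
    (v := fun x : ℝ => -Real.exp (-x ^ 2 / 2)) (u' := fun x : ℝ => n * x ^ (n - 1))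
    (v' := fun x : ℝ => x * Real.exp (-x ^ 2 / 2)) (fun x _ => hu x) (fun x _ => hv x)
    (by
      refine (integrable_pow_mul_exp_neg_sq_div_two (n + 1)).congr
        (Filter.Eventually.of_forall fun x => ?_)
      simp only [Pi.mul_apply]
      ring)
    (by
      refine ((integrable_pow_mul_exp_neg_sq_div_two (n - 1)).const_mul (-(n : ℝ))).congr
        (Filter.Eventually.of_forall fun x => ?_)
      simp only [Pi.mul_apply]
      ring)
    (by
      refine (integrable_pow_mul_exp_neg_sq_div_two n).neg.congr
        (Filter.Eventually.of_forall fun x => ?_)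
      simp only [Pi.mul_apply, Pi.neg_apply]
      ring)
  rw [gaussMoment, gaussMoment, ← integral_const_mul]
  calc ∫ x : ℝ, x ^ (n + 1) * Real.exp (-x ^ 2 / 2)
      = ∫ x : ℝ, x ^ n * (x * Real.exp (-x ^ 2 / 2)) := by
        congr 1; ext x; ring
    _ = _ := key
    _ = _ := by
        rw [← integral_neg]; congr 1; ext x; ring

/-! ### Standard Gaussian integrals of polynomials in several variables -/

variable {d : ℕ}

theorem prod_pow_mul_exp (s : Fin d →₀ ℕ) (z : Fin d → ℝ) :
    ∏ i, (z i ^ s i * Real.exp (-z i ^ 2 / 2))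
      = (∏ i, z i ^ s i) * Real.exp (-(∑ i, z i ^ 2) / 2) := by
  rw [Finset.prod_mul_distrib, ← Real.exp_sum]
  congr 2
  rw [← Finset.sum_div, Finset.sum_neg_distrib]

theorem integrable_eval_mul_exp (p : MvPolynomial (Fin d) ℝ) :
    Integrable fun z : Fin d → ℝ => MvPolynomial.eval z p * Real.exp (-(∑ i, z i ^ 2) / 2) := by
  have h : ∀ s : Fin d →₀ ℕ, Integrable fun z : Fin d → ℝ =>
      MvPolynomial.coeff s p * ((∏ i, z i ^ s i) * Real.exp (-(∑ i, z i ^ 2) / 2)) := by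
    intro s
    simp_rw [← prod_pow_mul_exp]
    exact (Integrable.fintype_prod fun i => integrable_pow_mul_exp_neg_sq_div_two (s i)).const_mul _
  refine (integrable_finsetSum p.support fun s _ => h s).congr
    (Filter.Eventually.of_forall fun z => ?_)
  simp only [MvPolynomial.eval_eq', Finset.sum_mul, mul_assoc]

/-- Integration of polynomials against the standard Gaussian weight. -/
def stdGauss : MvPolynomial (Fin d) ℝ →ₗ[ℝ] ℝ where
  toFun p := ∫ z : Fin d → ℝ, MvPolynomial.eval z p * Real.exp (-(∑ i, z i ^ 2) / 2)
  map_add' p q := by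
    rw [← integral_add (integrable_eval_mul_exp p) (integrable_eval_mul_exp q)]
    simp only [map_add, add_mul]
  map_smul' c p := by
    simp only [MvPolynomial.smul_eval, mul_assoc, integral_const_mul, RingHom.id_apply,
      smul_eq_mul]

theorem stdGauss_monomial (s : Fin d →₀ ℕ) (a : ℝ) :
    stdGauss (MvPolynomial.monomial s a) = a * ∏ i, gaussMoment (s i) := by
  change ∫ z : Fin d → ℝ, _ = _
  simp only [gaussMoment]
  rw [← integral_fintype_prod_volume_eq_prod (fun i (x : ℝ) => x ^ s i * Real.exp (-x ^ 2 / 2)),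
    ← integral_const_mul]
  congr 1
  ext z
  rw [prod_pow_mul_exp, MvPolynomial.eval_monomial, mul_assoc, Finsupp.prod_fintype]
  simp

theorem stdGauss_one : stdGauss (1 : MvPolynomial (Fin d) ℝ) = (2 * Real.pi) ^ ((d : ℝ) / 2) := by
  have h := stdGauss_monomial (0 : Fin d →₀ ℕ) 1
  rw [MvPolynomial.monomial_zero', map_one] at h
  rw [h]
  simp only [Finsupp.coe_zero, Pi.zero_apply, gaussMoment_zero, Finset.prod_const,
    Finset.card_univ, Fintype.card_fin, one_mul]
  rw [Real.sqrt_eq_rpow, ← Real.rpow_natCast, ← Real.rpow_mul (by positivity)]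
  congr 1
  ring

/-- Integration by parts for the standard Gaussian weight. -/
theorem stdGauss_X_mul (i : Fin d) (p : MvPolynomial (Fin d) ℝ) :
    stdGauss (MvPolynomial.X i * p) = stdGauss (MvPolynomial.pderiv i p) := by
  induction p using MvPolynomial.induction_on' with
  | add p q hp hq => rw [mul_add, map_add, map_add, map_add, hp, hq]
  | monomial s a =>
    rw [MvPolynomial.pderiv_monomial, MvPolynomial.X, MvPolynomial.monomial_mul, one_mul,
      stdGauss_monomial, stdGauss_monomial, ← Finset.mul_prod_erase _ _ (Finset.mem_univ i),
      ← Finset.mul_prod_erase Finset.univ (fun j => gaussMoment ((s - Finsupp.single i 1 : Fin d →₀ ℕ) j))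
        (Finset.mem_univ i)]
    have h : ∏ j ∈ Finset.univ.erase i, gaussMoment ((Finsupp.single i 1 + s : Fin d →₀ ℕ) j)
        = ∏ j ∈ Finset.univ.erase i, gaussMoment ((s - Finsupp.single i 1 : Fin d →₀ ℕ) j) := by
      refine Finset.prod_congr rfl fun j hj => ?_
      have hj : i ≠ j := (Finset.ne_of_mem_erase hj).symm
      simp [Finsupp.single_eq_of_ne' hj]
    rw [h]
    simp only [Finsupp.add_apply, Finsupp.single_eq_same, Finsupp.tsub_apply]
    rw [add_comm 1, gaussMoment_succ]
    ring

/-- The linear form with the given coefficients. -/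
def linForm (a : Fin d → ℝ) : MvPolynomial (Fin d) ℝ :=
  ∑ i, MvPolynomial.C (a i) * MvPolynomial.X i

theorem pderiv_linForm (i : Fin d) (a : Fin d → ℝ) :
    MvPolynomial.pderiv i (linForm a) = MvPolynomial.C (a i) := by
  rw [linForm, map_sum, Finset.sum_eq_single i]
  · simp
  · intro j _ hj
    simp [MvPolynomial.pderiv_X_of_ne hj]
  · simp

theorem pderiv_prod {ι : Type*} [DecidableEq ι] (i : Fin d) (f : ι → MvPolynomial (Fin d) ℝ)
    (S : Finset ι) :
    MvPolynomial.pderiv i (∏ h ∈ S, f h)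
      = ∑ h ∈ S, (∏ h' ∈ S.erase h, f h') * MvPolynomial.pderiv i (f h) := by
  induction S using Finset.induction_on with
  | empty => simp
  | insert a S ha ih =>
    rw [Finset.prod_insert ha, Finset.sum_insert ha, Finset.erase_insert ha, Derivation.leibniz,
      ih, smul_eq_mul, smul_eq_mul, Finset.mul_sum, add_comm]
    congr 1
    refine Finset.sum_congr rfl fun h hh => ?_
    have hne : a ≠ h := by rintro rfl; exact ha hh
    rw [Finset.erase_insert_of_ne hne, Finset.prod_insert fun h' => ha (Finset.mem_of_mem_erase h'),
      mul_assoc]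

/-- Integration by parts makes the first linear form act as a directional derivative; by Leibniz it
removes one other factor at a time and leaves a scalar product. This is the analytic half of the
recursion behind Wick's theorem. -/
theorem stdGauss_linForm_mul_prod {ι : Type*} [DecidableEq ι] (a₀ : Fin d → ℝ)
    (a : ι → Fin d → ℝ) (S : Finset ι) :
    stdGauss (linForm a₀ * ∏ h ∈ S, linForm (a h))
      = ∑ h ∈ S, (∑ i, a₀ i * a h i) * stdGauss (∏ h' ∈ S.erase h, linForm (a h')) := by
  have h1 : ∀ i, stdGauss (MvPolynomial.C (a₀ i) * MvPolynomial.X i * ∏ h ∈ S, linForm (a h))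
      = ∑ h ∈ S, a₀ i * a h i * stdGauss (∏ h' ∈ S.erase h, linForm (a h')) := by
    intro i
    rw [mul_assoc, ← MvPolynomial.smul_eq_C_mul, map_smul, stdGauss_X_mul,
      pderiv_prod, map_sum, smul_eq_mul, Finset.mul_sum]
    refine Finset.sum_congr rfl fun h _ => ?_
    rw [pderiv_linForm, mul_comm _ (MvPolynomial.C _), ← MvPolynomial.smul_eq_C_mul,
      map_smul, smul_eq_mul, mul_assoc]
  rw [linForm, Finset.sum_mul, map_sum, Finset.sum_congr rfl fun i _ => h1 i, Finset.sum_comm]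
  simp only [Finset.sum_mul]

/-! ### Perfect matchings and Wick's theorem -/

/-- The perfect matchings of a finite set, as involutions with that support. -/
def matchings {n : ℕ} (S : Finset (Fin n)) : Finset (Equiv.Perm (Fin n)) :=
  Finset.univ.filter fun f => (∀ x, f (f x) = x) ∧ ∀ x, f x ≠ x ↔ x ∈ S

/-- The product of the weights of the edges of a matching. -/
def matchingWeight {n : ℕ} (w : Fin n → Fin n → ℝ) (f : Fin n → Fin n) : ℝ :=
  ∏ h ∈ Finset.univ.filter (fun h => h < f h), w h (f h)

theorem matchings_empty {n : ℕ} : matchings (∅ : Finset (Fin n)) = {1} := by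
  ext f
  simp only [matchings, Finset.mem_filter, Finset.mem_univ, true_and, Finset.mem_singleton,
    Finset.notMem_empty, iff_false, not_not, Equiv.ext_iff, Equiv.Perm.one_apply]
  constructor
  · exact fun h => h.2
  · intro h
    exact ⟨fun x => by rw [h, h], h⟩

theorem swap_mul_apply_of_fixed {n : ℕ} {a b : Fin n} {f : Equiv.Perm (Fin n)}
    (ha : f a = a) (hb : f b = b) {x : Fin n} (hxa : x ≠ a) (hxb : x ≠ b) :
    (Equiv.swap a b * f) x = f x := by
  rw [Equiv.Perm.mul_apply, Equiv.swap_apply_of_ne_of_ne]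
  · intro h; exact hxa (f.injective (h.trans ha.symm))
  · intro h; exact hxb (f.injective (h.trans hb.symm))

/-- The combinatorial half of the Wick recursion: sort matchings by the partner of `a`. Minimality
of `a` makes it the representative of its edge, so the weight is `w a b` and no symmetry of `w` is
needed. -/
theorem sum_matchings_eq {n : ℕ} (w : Fin n → Fin n → ℝ) (S : Finset (Fin n)) (a : Fin n)
    (ha : a ∈ S) (hmin : ∀ x ∈ S, a ≤ x) :
    ∑ f ∈ matchings S, matchingWeight w f
      = ∑ b ∈ S.erase a, w a b *
          ∑ f ∈ matchings ((S.erase a).erase b), matchingWeight w f := by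
  simp only [Finset.mul_sum]
  rw [Finset.sum_sigma']
  symm
  -- A matching of the remaining points fixes `a` and `b`; composing it with their transposition
  -- adds the edge between them. The same composition also deletes the edge, which gives the inverse
  -- map below.
  have main : ∀ b ∈ S.erase a, ∀ f ∈ matchings ((S.erase a).erase b),
      (f a = a ∧ f b = b ∧ a ≠ b ∧ Equiv.swap a b * f ∈ matchings S ∧
        w a b * matchingWeight w f = matchingWeight w (Equiv.swap a b * f : Equiv.Perm _)) := by
    intro b hb f hf
    obtain ⟨hba, hbS⟩ := Finset.mem_erase.1 hb
    simp only [matchings, Finset.mem_filter, Finset.mem_univ, true_and] at hf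
    obtain ⟨hff, hfS⟩ := hf
    have h1 : f a = a := by
      by_contra h
      simpa using (hfS a).1 h
    have h2 : f b = b := by
      by_contra h
      simpa using (hfS b).1 h
    set g := Equiv.swap a b * f with hg
    have ga : g a = b := by simp [hg, h1]
    have gb : g b = a := by simp [hg, h2]
    have gx : ∀ x, x ≠ a → x ≠ b → g x = f x :=
      fun x hxa hxb => swap_mul_apply_of_fixed h1 h2 hxa hxb
    have fne : ∀ x, x ≠ a → x ≠ b → f x ≠ a ∧ f x ≠ b := fun x hxa hxb =>
      ⟨fun h => hxa (f.injective (h.trans h1.symm)), fun h => hxb (f.injective (h.trans h2.symm))⟩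
    refine ⟨h1, h2, hba.symm, ?_, ?_⟩
    · simp only [matchings, Finset.mem_filter, Finset.mem_univ, true_and]
      constructor
      · intro x
        by_cases hxa : x = a
        · rw [hxa, ga, gb]
        by_cases hxb : x = b
        · rw [hxb, gb, ga]
        rw [gx x hxa hxb, gx _ (fne x hxa hxb).1 (fne x hxa hxb).2, hff]
      · intro x
        by_cases hxa : x = a
        · rw [hxa, ga]
          exact ⟨fun _ => ha, fun _ => hba⟩
        by_cases hxb : x = b
        · rw [hxb, gb]
          exact ⟨fun _ => hbS, fun _ => hba.symm⟩
        rw [gx x hxa hxb, hfS]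
        simp [hxa, hxb]
    · have hset : Finset.univ.filter (fun h => h < g h)
          = insert a (Finset.univ.filter fun h => h < f h) := by
        ext x
        simp only [Finset.mem_filter, Finset.mem_univ, true_and, Finset.mem_insert]
        by_cases hxa : x = a
        · rw [hxa, ga]
          simpa using lt_of_le_of_ne (hmin b hbS) hba.symm
        by_cases hxb : x = b
        · rw [hxb, gb, h2]
          simpa [hba] using hmin b hbS
        rw [gx x hxa hxb]
        simp [hxa]
      rw [matchingWeight, matchingWeight, hset, Finset.prod_insert (by simp [h1]), ga]
      congr 1
      refine Finset.prod_congr rfl fun x hx => ?_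
      simp only [Finset.mem_filter, Finset.mem_univ, true_and] at hx
      rw [gx]
      · rintro rfl; rw [h1] at hx; exact lt_irrefl _ hx
      · rintro rfl; rw [h2] at hx; exact lt_irrefl _ hx
  refine Finset.sum_bij' (fun p _ => Equiv.swap a p.1 * p.2)
    (fun f _ => ⟨f a, Equiv.swap a (f a) * f⟩) ?_ ?_ ?_ ?_ ?_
  · rintro ⟨b, f⟩ h
    rw [Finset.mem_sigma] at h
    exact (main b h.1 f h.2).2.2.2.1
  · intro f hf
    simp only [matchings, Finset.mem_filter, Finset.mem_univ, true_and] at hf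
    obtain ⟨hff, hfS⟩ := hf
    have hfa : f a ≠ a := (hfS a).2 ha
    have hfaS : f a ∈ S := (hfS (f a)).1 (by rw [hff]; exact hfa.symm)
    simp only [Finset.mem_sigma, matchings, Finset.mem_filter, Finset.mem_univ, true_and,
      Finset.mem_erase]
    set g := Equiv.swap a (f a) * f with hg
    have ga : g a = a := by simp [hg]
    have gb : g (f a) = f a := by simp [hg, hff]
    have fne : ∀ x, x ≠ a → x ≠ f a → f x ≠ a ∧ f x ≠ f a := fun x hxa hxb =>
      ⟨fun h => hxb (by rw [← h, hff]), fun h => hxa (f.injective h)⟩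
    have gx : ∀ x, x ≠ a → x ≠ f a → g x = f x := fun x hxa hxb => by
      rw [hg, Equiv.Perm.mul_apply,
        Equiv.swap_apply_of_ne_of_ne (fne x hxa hxb).1 (fne x hxa hxb).2]
    refine ⟨⟨hfa, hfaS⟩, fun x => ?_, fun x => ?_⟩
    · by_cases hxa : x = a
      · rw [hxa, ga, ga]
      by_cases hxb : x = f a
      · rw [hxb, gb, gb]
      rw [gx x hxa hxb, gx _ (fne x hxa hxb).1 (fne x hxa hxb).2, hff]
    · by_cases hxa : x = a
      · simp [hxa, ga]
      by_cases hxb : x = f a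
      · rw [hxb, gb]; simp
      rw [gx x hxa hxb, hfS]
      simp [hxa, hxb]
  · rintro ⟨b, f⟩ h
    rw [Finset.mem_sigma] at h
    obtain ⟨h1, h2, h3, -, -⟩ := main b h.1 f h.2
    have : (Equiv.swap a b * f) a = b := by simp [h1]
    simp only [this, Equiv.swap_mul_self_mul]
  · intro f _
    simp
  · rintro ⟨b, f⟩ h
    rw [Finset.mem_sigma] at h
    exact (main b h.1 f h.2).2.2.2.2

/-- **Wick's theorem** for the standard Gaussian weight. -/
theorem stdGauss_prod_linForm {n : ℕ} (a : Fin n → Fin d → ℝ) (S : Finset (Fin n)) :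
    stdGauss (∏ h ∈ S, linForm (a h))
      = (2 * Real.pi) ^ ((d : ℝ) / 2) *
          ∑ f ∈ matchings S, matchingWeight (fun h h' => ∑ i, a h i * a h' i) f := by
  induction S using Finset.strongInduction with
  | H S ih =>
    rcases S.eq_empty_or_nonempty with rfl | hS
    · simp [matchings_empty, matchingWeight, stdGauss_one]
    · have hmem := S.min'_mem hS
      -- Both sides obey the same recursion when the least element is split off.
      rw [sum_matchings_eq _ S _ hmem fun x hx => S.min'_le x hx, Finset.mul_sum,
        ← Finset.mul_prod_erase S _ hmem, stdGauss_linForm_mul_prod]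
      refine Finset.sum_congr rfl fun b _ => ?_
      rw [ih _ ((Finset.erase_subset _ _).trans_ssubset (Finset.erase_ssubset hmem))]
      ring

/-! ### The Gaussian weight of a positive definite form -/

section GaussForm

open MeasureTheory Matrix

variable {d : ℕ} {V : Type*} [AddCommGroup V] [Module ℝ V]

theorem form_point_point (b : Module.Basis (Fin d) ℝ V) (B : LinearMap.BilinForm ℝ V)
    (c : Fin d → ℝ) : B (point b c) (point b c) = c ⬝ᵥ (gram b B *ᵥ c) := by
  simp only [point, map_sum, LinearMap.sum_apply, map_smul, LinearMap.smul_apply, smul_eq_mul,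
    dotProduct, mulVec, gram, Matrix.of_apply, Finset.mul_sum]
  rw [Finset.sum_comm]
  refine Finset.sum_congr rfl fun i _ => Finset.sum_congr rfl fun j _ => ?_
  ring

theorem gram_posDef (b : Module.Basis (Fin d) ℝ V) (B : LinearMap.BilinForm ℝ V)
    (hsymm : ∀ x y, B x y = B y x) (hpos : ∀ x, x ≠ 0 → 0 < B x x) : (gram b B).PosDef := by
  refine Matrix.PosDef.of_dotProduct_mulVec_pos ?_ fun {x} hx => ?_
  · ext i j
    simp [gram, hsymm (b i) (b j)]
  · rw [star_trivial, ← form_point_point]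
    refine hpos _ fun h => hx ?_
    ext i
    exact Fintype.linearIndependent_iff.1 b.linearIndependent x h i

-- A strictly positive element of the C*-algebra of matrices has the form star L * L with L
-- invertible. The substitution z = L c turns the form into the standard scalar product.
open scoped MatrixOrder in
theorem exists_gram_eq_transpose_mul_self {G : Matrix (Fin d) (Fin d) ℝ} (hG : G.PosDef) :
    ∃ L : Matrix (Fin d) (Fin d) ℝ, L.det ≠ 0 ∧ G = Lᵀ * L := by
  obtain ⟨L, hL, h⟩ := CStarAlgebra.isStrictlyPositive_iff_eq_star_mul_self.mp
    hG.isStrictlyPositive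
  refine ⟨L, ((Matrix.isUnit_iff_isUnit_det L).1 hL).ne_zero, ?_⟩
  rw [h, star_eq_conjTranspose, conjTranspose_eq_transpose_of_trivial]

theorem integrable_and_integral_comp_mulVec {L : Matrix (Fin d) (Fin d) ℝ} (hL : L.det ≠ 0)
    {f : (Fin d → ℝ) → ℝ} (hf : Integrable f) :
    Integrable (fun c => f (L *ᵥ c)) ∧ ∫ c, f (L *ᵥ c) = |L.det|⁻¹ * ∫ z, f z := by
  have hmap := Real.map_matrix_volume_pi_eq_smul_volume_pi hL
  have hmeas : AEMeasurable (toLin' L) (volume : Measure (Fin d → ℝ)) :=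
    (LinearMap.continuous_of_finiteDimensional (toLin' L)).measurable.aemeasurable
  have hf' : Integrable f (Measure.map (toLin' L) volume) := by
    rw [hmap]
    exact hf.smul_measure ENNReal.ofReal_ne_top
  constructor
  · have := hf'.comp_aemeasurable hmeas
    simpa [Function.comp_def] using this
  · have := integral_map hmeas hf'.aestronglyMeasurable
    simp only [toLin'_apply] at this
    rw [← this, hmap, integral_smul_measure, ENNReal.toReal_ofReal (abs_nonneg _), abs_inv,
      smul_eq_mul]

/-- The substitution of the coordinates `L⁻¹ z` into a polynomial. -/
def substInv (L : Matrix (Fin d) (Fin d) ℝ) : MvPolynomial (Fin d) ℝ →ₐ[ℝ] MvPolynomial (Fin d) ℝ :=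
  MvPolynomial.aeval fun i => linForm (L⁻¹ i)

theorem eval_substInv {L : Matrix (Fin d) (Fin d) ℝ} (hL : L.det ≠ 0)
    (p : MvPolynomial (Fin d) ℝ) (c : Fin d → ℝ) :
    MvPolynomial.eval (L *ᵥ c) (substInv L p) = MvPolynomial.eval c p := by
  have h : ∀ i, MvPolynomial.eval (L *ᵥ c) (linForm (L⁻¹ i)) = c i := by
    intro i
    have : (L⁻¹ *ᵥ (L *ᵥ c)) i = c i := by
      rw [mulVec_mulVec, nonsing_inv_mul _ (isUnit_iff_ne_zero.2 hL), one_mulVec]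
    rw [← this]
    simp [linForm, mulVec, dotProduct]
  induction p using MvPolynomial.induction_on with
  | C a => simp [substInv]
  | add p q hp hq => simp only [map_add, hp, hq]
  | mul_X p i hp =>
    rw [map_mul, map_mul, map_mul, hp, substInv, MvPolynomial.aeval_X, h, MvPolynomial.eval_X]

theorem exp_form_eq {G L : Matrix (Fin d) (Fin d) ℝ} (hGL : G = Lᵀ * L) (c : Fin d → ℝ) :
    c ⬝ᵥ (G *ᵥ c) = ∑ i, (L *ᵥ c) i ^ 2 := by
  rw [hGL, ← mulVec_mulVec, dotProduct_mulVec, vecMul_transpose]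
  simp only [dotProduct, sq]

variable (b : Module.Basis (Fin d) ℝ V) (B : LinearMap.BilinForm ℝ V)

theorem integrable_eval_mul_exp_form (hG : (gram b B).PosDef) (p : MvPolynomial (Fin d) ℝ) :
    Integrable fun c : Fin d → ℝ =>
      MvPolynomial.eval c p * Real.exp (-(B (point b c) (point b c)) / 2) := by
  obtain ⟨L, hL, hGL⟩ := exists_gram_eq_transpose_mul_self hG
  have := (integrable_and_integral_comp_mulVec hL (integrable_eval_mul_exp (substInv L p))).1
  simpa only [eval_substInv hL, ← exp_form_eq hGL, ← form_point_point] using this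

/-- Integration of polynomials in the coordinates against the Gaussian weight of `B`. -/
def gaussE (hG : (gram b B).PosDef) : MvPolynomial (Fin d) ℝ →ₗ[ℝ] ℝ where
  toFun p := ∫ c : Fin d → ℝ,
    MvPolynomial.eval c p * Real.exp (-(B (point b c) (point b c)) / 2)
  map_add' p q := by
    rw [← integral_add (integrable_eval_mul_exp_form b B hG p)
      (integrable_eval_mul_exp_form b B hG q)]
    simp only [map_add, add_mul]
  map_smul' c p := by
    simp only [MvPolynomial.smul_eval, mul_assoc, integral_const_mul, RingHom.id_apply,
      smul_eq_mul]

theorem gaussE_eq (hG : (gram b B).PosDef) {L : Matrix (Fin d) (Fin d) ℝ} (hL : L.det ≠ 0)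
    (hGL : gram b B = Lᵀ * L) (p : MvPolynomial (Fin d) ℝ) :
    gaussE b B hG p = |L.det|⁻¹ * stdGauss (substInv L p) := by
  have := (integrable_and_integral_comp_mulVec hL (integrable_eval_mul_exp (substInv L p))).2
  simpa only [eval_substInv hL, ← exp_form_eq hGL, ← form_point_point] using! this

/-- **Wick's theorem** for the Gaussian weight of `B`. -/
theorem gaussE_prod_X (hG : (gram b B).PosDef) {n : ℕ} (l : Fin n → Fin d) :
    gaussE b B hG (∏ h, MvPolynomial.X (l h))
      = (2 * Real.pi) ^ ((d : ℝ) / 2) / Real.sqrt (gram b B).det *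
          ∑ f ∈ matchings Finset.univ,
            matchingWeight (fun h h' => (gram b B)⁻¹ (l h) (l h')) f := by
  obtain ⟨L, hL, hGL⟩ := exists_gram_eq_transpose_mul_self hG
  rw [gaussE_eq b B hG hL hGL, map_prod]
  simp only [substInv, MvPolynomial.aeval_X]
  rw [stdGauss_prod_linForm]
  -- The Jacobian of the substitution supplies the determinant factor.
  have h1 : Real.sqrt (gram b B).det = |L.det| := by
    rw [hGL, det_mul, det_transpose, Real.sqrt_mul_self_eq_abs]
  -- The old coordinates are linear forms with the rows of L⁻¹ as coefficients, so their covariances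
  -- are the entries of L⁻¹(L⁻¹)ᵀ = (LᵀL)⁻¹.
  have h2 : ∀ i j, ∑ k, L⁻¹ i k * L⁻¹ j k = (gram b B)⁻¹ i j := by
    intro i j
    rw [hGL, Matrix.mul_inv_rev, ← transpose_nonsing_inv, mul_apply]
    simp only [transpose_apply]
  simp only [h2, h1]
  ring

end GaussForm

/-! ### Invariance under isomorphism and counting of labelled graphs -/

namespace GenusGraph

theorem two_mul_card_edges (Γ : GenusGraph) : 2 * Γ.edges.card = Γ.nH := by
  have h1 : (Finset.univ.filter fun h => ¬ h < Γ.opp h).card = Γ.edges.card := by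
    refine Finset.card_bij' (fun h _ => Γ.opp h) (fun h _ => Γ.opp h) ?_ ?_ ?_ ?_
    · intro h hh
      simp only [Finset.mem_filter, Finset.mem_univ, true_and, not_lt, edges, Γ.opp_opp] at hh ⊢
      exact lt_of_le_of_ne hh (Γ.opp_ne h)
    · intro h hh
      simp only [Finset.mem_filter, Finset.mem_univ, true_and, not_lt, edges, Γ.opp_opp] at hh ⊢
      exact hh.le
    · intro h _; exact Γ.opp_opp h
    · intro h _; exact Γ.opp_opp h
  have h2 := Finset.card_filter_add_card_filter_not (s := Finset.univ) (fun h => h < Γ.opp h)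
  rw [h1, Finset.card_univ, Fintype.card_fin] at h2
  change Γ.edges.card + _ = _ at h2
  omega

theorem sum_valence (Γ : GenusGraph) : ∑ v, Γ.valence v = Γ.nH := by
  have := Finset.card_eq_sum_card_fiberwise (s := Finset.univ) (t := Finset.univ) (f := Γ.root)
    (fun _ _ => Finset.mem_coe.2 (Finset.mem_univ _))
  rw [Finset.card_univ, Fintype.card_fin] at this
  rw [this]
  exact Finset.sum_congr rfl fun v _ => Fintype.card_subtype _

/-- The exponent of ħ^{1/2} sees only the genera and the numbers of vertices and half-edges, so it
is constant in sums over attachments and gluings. -/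
theorem two_mul_neg_eulerChar (Γ : GenusGraph) :
    2 * -Γ.eulerChar = 2 * (∑ v, (Γ.genus v : ℤ)) - 2 * Γ.nV + Γ.nH := by
  have := Γ.two_mul_card_edges
  rw [eulerChar]
  omega

/-! ### Invariants of a graph under isomorphism -/

section Invariance

variable {Γ Δ : GenusGraph}

/-- An isomorphism identifies the half-edges at corresponding vertices. -/
def Iso.halfEdgesAt (i : Iso Γ Δ) (v : Fin Γ.nV) : Γ.HalfEdgesAt v ≃ Δ.HalfEdgesAt (i.1.1 v) :=
  i.1.2.subtypeEquiv fun h => by rw [i.2.1 h, EmbeddingLike.apply_eq_iff_eq]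

theorem Iso.valence_eq (i : Iso Γ Δ) (v : Fin Γ.nV) : Δ.valence (i.1.1 v) = Γ.valence v :=
  (Fintype.card_congr (i.halfEdgesAt v)).symm

theorem Iso.nV_eq (i : Iso Γ Δ) : Γ.nV = Δ.nV := by simpa using Fintype.card_congr i.1.1

theorem Iso.nH_eq (i : Iso Γ Δ) : Γ.nH = Δ.nH := by simpa using Fintype.card_congr i.1.2

theorem Iso.eulerChar_eq (i : Iso Γ Δ) : Δ.eulerChar = Γ.eulerChar := by
  have h1 := Γ.two_mul_neg_eulerChar
  have h2 := Δ.two_mul_neg_eulerChar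
  have h3 : ∑ v, (Δ.genus v : ℤ) = ∑ v, (Γ.genus v : ℤ) := by
    rw [← Equiv.sum_comp i.1.1]
    exact Finset.sum_congr rfl fun v _ => by rw [i.2.2.2]
  have h4 := i.nV_eq
  have h5 := i.nH_eq
  rw [h3] at h2
  omega

/-- An isomorphism need not send the smaller half of an edge to the smaller half of its image. The
bijection of representatives switches halves where necessary, and symmetry of `w` absorbs the
switch. -/
theorem Iso.prod_edges (i : Iso Γ Δ) (w : Fin Δ.nH → Fin Δ.nH → ℝ)
    (hw : ∀ h h', w h h' = w h' h) :
    ∏ h ∈ Δ.edges, w h (Δ.opp h) = ∏ h ∈ Γ.edges, w (i.1.2 h) (i.1.2 (Γ.opp h)) := by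
  have hopp := i.2.2.1
  have hopp' : ∀ h, i.1.2.symm (Δ.opp h) = Γ.opp (i.1.2.symm h) := fun h => by
    rw [Equiv.symm_apply_eq, ← hopp, Equiv.apply_symm_apply]
  generalize i.1.2 = q at hopp hopp'
  symm
  have ne : ∀ h, ¬ h < Γ.opp h → Γ.opp h < h := fun h hh =>
    lt_of_le_of_ne (not_lt.1 hh) (Γ.opp_ne h)
  have ne' : ∀ h, ¬ h < Δ.opp h → Δ.opp h < h := fun h hh =>
    lt_of_le_of_ne (not_lt.1 hh) (Δ.opp_ne h)
  refine Finset.prod_bij' (fun h _ => if q h < Δ.opp (q h) then q h else Δ.opp (q h))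
    (fun h _ => if q.symm h < Γ.opp (q.symm h) then q.symm h else Γ.opp (q.symm h)) ?_ ?_ ?_ ?_ ?_
  · intro h _
    simp only [edges, Finset.mem_filter, Finset.mem_univ, true_and]
    split_ifs with h1
    · exact h1
    · rw [Δ.opp_opp]; exact ne' _ h1
  · intro h _
    simp only [edges, Finset.mem_filter, Finset.mem_univ, true_and]
    split_ifs with h1
    · exact h1
    · rw [Γ.opp_opp]; exact ne _ h1
  · intro h hh
    simp only [edges, Finset.mem_filter, Finset.mem_univ, true_and] at hh
    split_ifs with h1 h2 h2
    · simp
    · simp only [Equiv.symm_apply_apply] at h2; exact absurd hh h2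
    · simp only [hopp', Equiv.symm_apply_apply, Γ.opp_opp] at h2
      exact absurd h2 hh.not_gt
    · simp [hopp', Γ.opp_opp]
  · intro h hh
    simp only [edges, Finset.mem_filter, Finset.mem_univ, true_and] at hh
    split_ifs with h1 h2 h2
    · simp
    · simp only [Equiv.apply_symm_apply] at h2; exact absurd hh h2
    · simp only [← hopp', Equiv.apply_symm_apply, Δ.opp_opp] at h2
      exact absurd h2 hh.not_gt
    · simp [← hopp', Δ.opp_opp]
  · intro h _
    split_ifs with h1
    · rw [hopp]
    · rw [Δ.opp_opp, hopp, hw]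

end Invariance

/-! ### Renumberings of a graph and their stabilizer -/

section Count

variable (Γ : GenusGraph)

/-- The graph obtained by renumbering vertices and half-edges. -/
def renumber (σ : Equiv.Perm (Fin Γ.nV) × Equiv.Perm (Fin Γ.nH)) : GenusGraph where
  nV := Γ.nV
  nH := Γ.nH
  root h := σ.1 (Γ.root (σ.2.symm h))
  opp h := σ.2 (Γ.opp (σ.2.symm h))
  opp_opp h := by simp [Γ.opp_opp]
  opp_ne h e := Γ.opp_ne _ (σ.2.eq_symm_apply.2 e)
  genus v := Γ.genus (σ.1.symm v)

/-- The isomorphism from a graph to a renumbered one. -/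
def isoRenumber (σ : Equiv.Perm (Fin Γ.nV) × Equiv.Perm (Fin Γ.nH)) : Iso Γ (Γ.renumber σ) :=
  ⟨σ, fun h => congrArg (fun h' => σ.1 (Γ.root h')) (σ.2.symm_apply_apply h),
    fun h => congrArg (fun h' => σ.2 (Γ.opp h')) (σ.2.symm_apply_apply h),
    fun v => congrArg Γ.genus (σ.1.symm_apply_apply v)⟩

theorem exists_renumber_eq {Δ : GenusGraph} (i : Iso Γ Δ) : ∃ σ, Γ.renumber σ = Δ := by
  obtain ⟨nV, nH, root, opp, opp_opp, opp_ne, genus⟩ := Δ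
  -- Once `Δ` is taken apart its sizes are variables, so they can be substituted and no transport
  -- between `Fin` types is left.
  obtain rfl : Γ.nV = nV := i.nV_eq
  obtain rfl : Γ.nH = nH := i.nH_eq
  obtain ⟨⟨p, q⟩, h1, h2, h3⟩ := i
  refine ⟨(p, q), ?_⟩
  simp only [renumber, GenusGraph.mk.injEq, heq_eq_eq, true_and]
  refine ⟨funext fun h => ?_, funext fun h => ?_, funext fun v => ?_⟩
  · have := h1 (q.symm h)
    simpa using this.symm
  · have := h2 (q.symm h)
    simpa using this.symm
  · have := h3 (p.symm v)
    simpa using this.symm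

theorem renumber_eq_iff (σ τ : Equiv.Perm (Fin Γ.nV) × Equiv.Perm (Fin Γ.nH)) :
    Γ.renumber σ = Γ.renumber τ ↔
      (∀ h, Γ.root ((τ⁻¹ * σ).2 h) = (τ⁻¹ * σ).1 (Γ.root h)) ∧
      (∀ h, Γ.opp ((τ⁻¹ * σ).2 h) = (τ⁻¹ * σ).2 (Γ.opp h)) ∧
      (∀ v, Γ.genus ((τ⁻¹ * σ).1 v) = Γ.genus v) := by
  simp only [renumber, GenusGraph.mk.injEq, heq_eq_eq, true_and]
  refine and_congr ?_ (and_congr ?_ ?_)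
  · rw [funext_iff, ← σ.2.forall_congr_right]
    refine forall_congr' fun h => ?_
    simp only [Equiv.symm_apply_apply]
    exact ⟨fun e => by
      change _ = τ.1.symm (σ.1 _)
      rw [e]; exact (τ.1.symm_apply_apply _).symm, fun e => by
      change _ = τ.1.symm (σ.1 _) at e
      rw [Equiv.eq_symm_apply] at e; exact e.symm⟩
  · rw [funext_iff, ← σ.2.forall_congr_right]
    refine forall_congr' fun h => ?_
    simp only [Equiv.symm_apply_apply]
    exact ⟨fun e => by
      change _ = τ.2.symm (σ.2 _)
      rw [e]; exact (τ.2.symm_apply_apply _).symm, fun e => by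
      change _ = τ.2.symm (σ.2 _) at e
      rw [Equiv.eq_symm_apply] at e; exact e.symm⟩
  · rw [funext_iff, ← σ.1.forall_congr_right]
    refine forall_congr' fun v => ?_
    simp only [Equiv.symm_apply_apply]
    exact eq_comm

/-- The renumberings with a given result form a coset of the automorphism group. -/
def renumberFiberEquiv (τ : Equiv.Perm (Fin Γ.nV) × Equiv.Perm (Fin Γ.nH)) :
    {σ // Γ.renumber σ = Γ.renumber τ} ≃ Γ.Aut :=
  (Equiv.mulLeft τ⁻¹).subtypeEquiv fun σ => Γ.renumber_eq_iff σ τ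

-- Orbit-stabilizer: the pairs of permutations act on labelled graphs, and every fibre of the orbit
-- map is a coset of the automorphisms.
open Classical in
theorem card_renumber_mul_card_aut :
    (Finset.univ.image Γ.renumber).card * Nat.card Γ.Aut = Γ.nV.factorial * Γ.nH.factorial := by
  have h1 : Fintype.card (Equiv.Perm (Fin Γ.nV) × Equiv.Perm (Fin Γ.nH))
      = Γ.nV.factorial * Γ.nH.factorial := by
    rw [Fintype.card_prod, Fintype.card_perm, Fintype.card_perm, Fintype.card_fin,
      Fintype.card_fin]
  rw [← h1, ← Finset.card_univ, Finset.card_eq_sum_card_image Γ.renumber Finset.univ,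
    Finset.sum_const_nat fun Δ hΔ => ?_]
  obtain ⟨τ, -, rfl⟩ := Finset.mem_image.1 hΔ
  rw [← Nat.card_congr (Γ.renumberFiberEquiv τ), Nat.card_eq_fintype_card, Fintype.card_subtype]

theorem card_aut_pos : 0 < Nat.card Γ.Aut :=
  have : Nonempty Γ.Aut := ⟨⟨(Equiv.refl _, Equiv.refl _), by simp⟩⟩
  Nat.card_pos

end Count

/-- A sum over labelled graphs, each weighted by the inverse number of labellings, is a sum over
isomorphism classes weighted by the inverse order of the automorphism group. -/
theorem hasSum_graphClass {F : GenusGraph → ℝ} (hF : ∀ Γ Δ : GenusGraph, Iso Γ Δ → F Δ = F Γ)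
    {a : ℝ} (h : HasSum (fun Γ : GenusGraph => F Γ / (Γ.nV.factorial * Γ.nH.factorial)) a) :
    HasSum (fun c : GraphClass => F c.rep / (Nat.card c.rep.Aut : ℝ)) a := by
  classical
  let π : GenusGraph → GraphClass := Quotient.mk _
  have h' := (Equiv.sigmaFiberEquiv π).hasSum_iff.2 h
  refine h'.sigma fun c => ?_
  set Γ := c.rep with hΓ
  have hc : π Γ = c := Quotient.out_eq c
  -- The fibre over a class is the orbit of its representative. Hence it is finite, and the summand
  -- is constant on it.
  have hiso : ∀ Δ : GenusGraph, π Δ = c ↔ Δ ∈ Finset.univ.image Γ.renumber := by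
    intro Δ
    rw [← hc, eq_comm, Finset.mem_image]
    refine Quotient.eq.trans ?_
    constructor
    · rintro ⟨i⟩
      obtain ⟨σ, hσ⟩ := Γ.exists_renumber_eq i
      exact ⟨σ, Finset.mem_univ _, hσ⟩
    · rintro ⟨σ, -, rfl⟩
      exact ⟨Γ.isoRenumber σ⟩
  let _ : Fintype {Δ // π Δ = c} := Fintype.subtype (Finset.univ.image Γ.renumber)
    fun Δ => (hiso Δ).symm
  have hcard : Fintype.card {Δ // π Δ = c} = (Finset.univ.image Γ.renumber).card :=
    Fintype.card_of_subtype _ fun Δ => (hiso Δ).symm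
  have hval : ∀ Δ : {Δ // π Δ = c},
      F Δ.1 / (Δ.1.nV.factorial * Δ.1.nH.factorial) = F Γ / (Γ.nV.factorial * Γ.nH.factorial) := by
    intro Δ
    obtain ⟨i⟩ : Nonempty (Iso Γ Δ.1) := Quotient.exact (hc.trans Δ.2.symm)
    rw [hF _ _ i, ← i.nV_eq, ← i.nH_eq]
  have hs := hasSum_fintype fun Δ : {Δ // π Δ = c} =>
    F Δ.1 / (Δ.1.nV.factorial * Δ.1.nH.factorial)
  rw [Finset.sum_congr rfl fun Δ _ => hval Δ, Finset.sum_const, Finset.card_univ, hcard,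
    nsmul_eq_mul, ← Nat.cast_mul, ← Γ.card_renumber_mul_card_aut] at hs
  have h1 : (Nat.card Γ.Aut : ℝ) ≠ 0 := Nat.cast_ne_zero.2 Γ.card_aut_pos.ne'
  have h2 : ((Finset.univ.image Γ.renumber).card : ℝ) ≠ 0 :=
    Nat.cast_ne_zero.2 (Finset.card_pos.2 ⟨_, Finset.mem_image_of_mem _ (Finset.mem_univ 1)⟩).ne'
  have h3 : F Γ / (Nat.card Γ.Aut : ℝ) = (Finset.univ.image Γ.renumber).card *
      (F Γ / ((Finset.univ.image Γ.renumber).card * Nat.card Γ.Aut : ℕ)) := by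
    push_cast
    field_simp
  rw [h3]
  exact hs

theorem numValence_eq_zero (Γ : GenusGraph) {i : ℕ} (hi : Γ.nH < i) : Γ.numValence i = 0 := by
  rw [numValence, Finset.card_eq_zero, Finset.filter_eq_empty_iff]
  intro v _ hv
  have := Fintype.card_subtype_le fun h => Γ.root h = v
  rw [Fintype.card_fin] at this
  change Fintype.card {h // Γ.root h = v} = i at hv
  omega

/-- The isomorphism classes, sorted by the numbers of vertices of each valence. -/
def sigmaValencesEquiv : (Σ n : ℕ →₀ ℕ, GraphsWithValences n) ≃ GraphClass :=
  Equiv.ofBijective (fun x => x.2.1) (by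
    constructor
    · rintro ⟨n, c, hn⟩ ⟨n', c', hn'⟩ (rfl : c = c')
      obtain rfl : n = n' := Finsupp.ext fun i => (hn i).symm.trans (hn' i)
      rfl
    · intro c
      have hfin : (Function.support c.rep.numValence).Finite :=
        (Set.finite_Iic c.rep.nH).subset fun i hi => by
          by_contra h
          exact hi (c.rep.numValence_eq_zero (not_le.1 h))
      exact ⟨⟨Finsupp.ofSupportFinite _ hfin, c, fun i => rfl⟩, rfl⟩)

end GenusGraph

/-! ### Invariance of amplitudes under isomorphism -/

section

variable {d : ℕ} {V : Type*} [AddCommGroup V] [Module ℝ V]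
  (C : ∀ _g m : ℕ, MultilinearMap ℝ (fun _ : Fin m => V) ℝ)

/-- Letting genus and valence be free variables allows vertices of two isomorphic graphs to be
compared without casting the arity of the tensor. -/
theorem vertexValue_eq_of_valence (Γ : GenusGraph) (v : Fin Γ.nV) (x : Fin Γ.nH → V) {g m : ℕ}
    (hg : Γ.genus v = g) (hm : Γ.valence v = m) :
    vertexValue C Γ v x = ((m.factorial : ℝ))⁻¹ *
      ∑ e : Fin m ≃ Γ.HalfEdgesAt v, -(C g m fun j => x (e j).1) := by
  subst hm hg
  rfl

theorem vertexValue_iso {Γ Δ : GenusGraph} (i : GenusGraph.Iso Γ Δ) (v : Fin Γ.nV)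
    (x : Fin Δ.nH → V) :
    vertexValue C Δ (i.1.1 v) x = vertexValue C Γ v fun h => x (i.1.2 h) := by
  rw [vertexValue_eq_of_valence C Δ _ x (i.2.2.2 v) (i.valence_eq v),
    vertexValue_eq_of_valence C Γ v _ rfl rfl]
  congr 1
  exact (Fintype.sum_equiv (Equiv.equivCongr (Equiv.refl _) (i.halfEdgesAt v)) _ _
    fun e => rfl).symm

theorem amplitude_iso (b : Module.Basis (Fin d) ℝ V) {B : LinearMap.BilinForm ℝ V}
    (hsymm : ∀ i j, (gram b B)⁻¹ i j = (gram b B)⁻¹ j i)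
    {Γ Δ : GenusGraph} (i : GenusGraph.Iso Γ Δ) : amplitude b B C Δ = amplitude b B C Γ := by
  rw [amplitude, amplitude]
  refine Fintype.sum_equiv (i.1.2.symm.arrowCongr (Equiv.refl _)) _ _ fun l => ?_
  rw [i.prod_edges (fun h h' => (gram b B)⁻¹ (l h) (l h')) fun h h' => hsymm _ _,
    ← Equiv.prod_comp i.1.1]
  simp only [vertexValue_iso]
  rfl

end

/-! ### Sums over gluings and attachments -/

/-- Fixed-point free involutions of the half-edges. -/
abbrev Gluing (n : ℕ) : Type := {f : Fin n → Fin n // (∀ h, f (f h) = h) ∧ ∀ h, f h ≠ h}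

/-- The graph with given genera, attachments and gluing. -/
def mkGraph {N M : ℕ} (γ : Fin N → ℕ) (ρ : Fin M → Fin N) (o : Gluing M) : GenusGraph where
  nV := N
  nH := M
  root := ρ
  opp := o.1
  opp_opp := o.2.1
  opp_ne := o.2.2
  genus := γ

/-- The number of half-edges attached to `v`. -/
def fiberCard {N M : ℕ} (ρ : Fin M → Fin N) (v : Fin N) : ℕ := Fintype.card {h // ρ h = v}

theorem sum_gluing_eq_sum_matchings {n : ℕ} (F : (Fin n → Fin n) → ℝ) :
    ∑ o : Gluing n, F o.1 = ∑ f ∈ matchings Finset.univ, F f := by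
  refine Finset.sum_bij' (fun o _ => ⟨o.1, o.1, o.2.1, o.2.1⟩)
    (fun f hf => ⟨f, by
      simp only [matchings, Finset.mem_filter, Finset.mem_univ, true_and, iff_true] at hf
      exact hf⟩) ?_ ?_ ?_ ?_ ?_
  · intro o _
    simp only [matchings, Finset.mem_filter, Finset.mem_univ, true_and, iff_true]
    exact o.2
  · intro f _
    exact Finset.mem_univ _
  · intro o _
    rfl
  · intro f _
    ext
    rfl
  · intro o _
    rfl

theorem comp_update_eq {V : Type*} {N M : ℕ} (ρ : Fin M → Fin N) [DecidableEq (Fin M)]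
    {v : Fin N} {m : ℕ} (e : Fin m ≃ {h // ρ h = v}) (x : Fin M → V)
    (h : Fin M) (hv : ρ h = v) (a : V) :
    (fun j => Function.update x h a (e j).1)
      = Function.update (fun j => x (e j).1) (e.symm ⟨h, hv⟩) a := by
  funext j
  by_cases hj : j = e.symm ⟨h, hv⟩
  · subst hj
    simp
  · rw [Function.update_of_ne hj, Function.update_of_ne]
    intro h'
    exact hj (by rw [Equiv.eq_symm_apply]; exact Subtype.ext h')

/-! ### Vertex tensors as polynomials, and the interaction series -/

section Polynomials

variable {d : ℕ} {V : Type*} [AddCommGroup V] [Module ℝ V]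
  (b : Module.Basis (Fin d) ℝ V) (B : LinearMap.BilinForm ℝ V)
  (C : ∀ _g m : ℕ, MultilinearMap ℝ (fun _ : Fin m => V) ℝ)

/-- The polynomial function `x ↦ C g m (x, …, x)` in coordinates. -/
def formPoly (g m : ℕ) : MvPolynomial (Fin d) ℝ :=
  ∑ l : Fin m → Fin d, MvPolynomial.C (C g m fun j => b (l j)) * ∏ j, MvPolynomial.X (l j)

theorem multilinear_point {n : ℕ} (f : MultilinearMap ℝ (fun _ : Fin n => V) ℝ) (c : Fin d → ℝ) :
    f (fun _ => point b c) = ∑ l : Fin n → Fin d, f (fun j => b (l j)) * ∏ j, c (l j) := by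
  simp only [point]
  rw [MultilinearMap.map_sum]
  refine Finset.sum_congr rfl fun l _ => ?_
  rw [MultilinearMap.map_smul_univ, smul_eq_mul, mul_comm]

theorem eval_formPoly (g m : ℕ) (c : Fin d → ℝ) :
    MvPolynomial.eval c (formPoly b C g m) = C g m fun _ => point b c := by
  rw [multilinear_point, formPoly]
  simp

section Vertices

variable {N M : ℕ} (γ : Fin N → ℕ) (ρ : Fin M → Fin N)

/-- The value of a vertex, which does not depend on the gluing. -/
def vertexForm (v : Fin N) (x : Fin M → V) : ℝ :=
  (((fiberCard ρ v).factorial : ℝ))⁻¹ *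
    ∑ e : Fin (fiberCard ρ v) ≃ {h // ρ h = v},
      -(C (γ v) (fiberCard ρ v) fun j => x (e j).1)

/-- On the diagonal all orderings of the half-edges give the same value. This is why tensors that
are not symmetric cause no difficulty: the action sees only their diagonal values. -/
theorem vertexForm_const (v : Fin N) (y : V) :
    vertexForm C γ ρ v (fun _ => y) = -(C (γ v) (fiberCard ρ v) fun _ => y) := by
  have hcard : Fintype.card (Fin (fiberCard ρ v) ≃ {h // ρ h = v})
      = (fiberCard ρ v).factorial := by
    rw [Fintype.card_equiv (Fintype.equivFinOfCardEq (n := fiberCard ρ v) rfl).symm,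
      Fintype.card_fin]
  have hne : ((fiberCard ρ v).factorial : ℝ) ≠ 0 := by positivity
  rw [vertexForm, Finset.sum_const, Finset.card_univ, hcard, nsmul_eq_mul,
    inv_mul_cancel_left₀ hne]

theorem vertexForm_update_of_ne [DecidableEq (Fin M)] {v : Fin N} (x : Fin M → V) (h : Fin M)
    (hv : ρ h ≠ v) (a : V) :
    vertexForm C γ ρ v (Function.update x h a) = vertexForm C γ ρ v x := by
  rw [vertexForm, vertexForm]
  congr 1
  refine Finset.sum_congr rfl fun e _ => ?_
  congr 2
  funext j
  rw [Function.update_of_ne]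
  intro h'
  exact hv (by rw [← h']; exact (e j).2)

theorem vertexForm_update_add [DecidableEq (Fin M)] (x : Fin M → V) (h : Fin M) (a a' : V) :
    vertexForm C γ ρ (ρ h) (Function.update x h (a + a'))
      = vertexForm C γ ρ (ρ h) (Function.update x h a)
        + vertexForm C γ ρ (ρ h) (Function.update x h a') := by
  simp only [vertexForm, comp_update_eq ρ _ x h rfl, MultilinearMap.map_update_add]
  rw [← mul_add, ← Finset.sum_add_distrib]
  congr 1
  exact Finset.sum_congr rfl fun e _ => by ring

theorem vertexForm_update_smul [DecidableEq (Fin M)] (x : Fin M → V) (h : Fin M) (t : ℝ) (a : V) :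
    vertexForm C γ ρ (ρ h) (Function.update x h (t • a))
      = t * vertexForm C γ ρ (ρ h) (Function.update x h a) := by
  simp only [vertexForm, comp_update_eq ρ _ x h rfl, MultilinearMap.map_update_smul, smul_eq_mul]
  rw [mul_left_comm, Finset.mul_sum (a := t)]
  congr 1
  exact Finset.sum_congr rfl fun e _ => by ring

/-- Each half-edge enters only the factor of its own vertex; this makes the product over vertices
linear in every half-edge. -/
theorem prod_vertexForm_update [DecidableEq (Fin M)] (x : Fin M → V) (h : Fin M) (a : V) :
    ∏ v, vertexForm C γ ρ v (Function.update x h a)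
      = vertexForm C γ ρ (ρ h) (Function.update x h a) *
          ∏ v ∈ Finset.univ.erase (ρ h), vertexForm C γ ρ v x := by
  rw [← Finset.mul_prod_erase _ _ (Finset.mem_univ (ρ h))]
  congr 1
  exact Finset.prod_congr rfl fun v hv =>
    vertexForm_update_of_ne C γ ρ x h (Finset.ne_of_mem_erase hv).symm a

/-- The product of the tensors at all vertices, as a multilinear map of the half-edges. -/
def verticesForm : MultilinearMap ℝ (fun _ : Fin M => V) ℝ where
  toFun x := ∏ v, vertexForm C γ ρ v x
  map_update_add' x h a a' := by
    rw [prod_vertexForm_update, prod_vertexForm_update, prod_vertexForm_update,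
      vertexForm_update_add, add_mul]
  map_update_smul' x h t a := by
    rw [prod_vertexForm_update, prod_vertexForm_update, vertexForm_update_smul, smul_eq_mul,
      mul_assoc]

/-- Polynomials over ℝ are determined by their values, and at a point both sides are the product of
vertex tensors with that point inserted at all half-edges. -/
theorem sum_verticesForm_eq_prod_formPoly :
    ∑ l : Fin M → Fin d, verticesForm C γ ρ (fun h => b (l h)) • ∏ h, MvPolynomial.X (l h)
      = ∏ v, -formPoly b C (γ v) (fiberCard ρ v) := by
  refine MvPolynomial.funext fun c => ?_
  simp only [map_sum, map_prod, map_neg, eval_formPoly, MvPolynomial.smul_eval,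
    MvPolynomial.eval_X]
  rw [← multilinear_point]
  change ∏ v, vertexForm C γ ρ v (fun _ => point b c) = _
  exact Finset.prod_congr rfl fun v _ => vertexForm_const C γ ρ v (point b c)

/-- The sum of the amplitudes over all gluings is a Gaussian expectation. -/
theorem sum_gluing_amplitude (hG : (gram b B).PosDef) :
    ∑ o : Gluing M, (2 * Real.pi) ^ ((d : ℝ) / 2) / Real.sqrt (gram b B).det *
        amplitude b B C (mkGraph γ ρ o)
      = gaussE b B hG (∏ v, -formPoly b C (γ v) (fiberCard ρ v)) := by
  -- The gluing enters only through the edge factors, so for each labelling of half-edges the sum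
  -- over gluings is a Wick sum.
  have h1 : ∀ o : Gluing M, amplitude b B C (mkGraph γ ρ o)
      = ∑ l : Fin M → Fin d, verticesForm C γ ρ (fun h => b (l h)) *
          matchingWeight (fun h h' => (gram b B)⁻¹ (l h) (l h')) o.1 := fun o => rfl
  simp only [h1]
  rw [← sum_verticesForm_eq_prod_formPoly, map_sum, ← Finset.mul_sum, Finset.sum_comm,
    Finset.mul_sum]
  refine Finset.sum_congr rfl fun l _ => ?_
  rw [map_smul, gaussE_prod_X, smul_eq_mul, ← Finset.mul_sum,
    sum_gluing_eq_sum_matchings (matchingWeight fun h h' => (gram b B)⁻¹ (l h) (l h'))]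
  ring

end Vertices

/-- Sums over attachments reduce to sums over valences, with multinomial coefficients. -/
theorem sum_attachments {R : Type*} [CommRing R] {N : ℕ} (M : ℕ) (F : Fin N → ℕ → R) :
    ∑ ρ : Fin M → Fin N, ∏ v, F v (fiberCard ρ v)
      = ∑ m ∈ Finset.piAntidiag Finset.univ M,
          (Nat.multinomial Finset.univ m : R) * ∏ v, F v (m v) := by
  -- This functional is applied to two expansions of (∑ X_v)^M: the one over all maps ρ, and the
  -- multinomial one.
  let Λ : MvPolynomial (Fin N) R →ₗ[R] R :=
    (MvPolynomial.basisMonomials (Fin N) R).constr R fun s => ∏ v, F v (s v)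
  have hΛ : ∀ s : Fin N →₀ ℕ, Λ (MvPolynomial.monomial s 1) = ∏ v, F v (s v) := by
    intro s
    have := (MvPolynomial.basisMonomials (Fin N) R).constr_basis R
      (fun s : Fin N →₀ ℕ => ∏ v, F v (s v)) s
    rwa [MvPolynomial.coe_basisMonomials] at this
  have h1 := Fintype.sum_pow (fun v : Fin N => (MvPolynomial.X v : MvPolynomial (Fin N) R)) M
  rw [Finset.sum_pow_eq_sum_piAntidiag] at h1
  have h2 := congrArg Λ h1
  rw [map_sum, map_sum] at h2
  rw [← Finset.sum_congr rfl fun ρ _ => ?_, ← h2, Finset.sum_congr rfl fun m _ => ?_]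
  · have : ∏ v, (MvPolynomial.X v : MvPolynomial (Fin N) R) ^ m v
        = MvPolynomial.monomial (Finsupp.equivFunOnFinite.symm m) 1 := by
      rw [MvPolynomial.monomial_eq, map_one, one_mul, Finsupp.prod_fintype _ _ fun _ => pow_zero _]
      rfl
    rw [this, ← nsmul_eq_mul, map_nsmul, hΛ, nsmul_eq_mul]
    rfl
  · have : ∏ h, (MvPolynomial.X (ρ h) : MvPolynomial (Fin N) R)
        = MvPolynomial.monomial (∑ h, Finsupp.single (ρ h) 1) 1 := by
      rw [MvPolynomial.monomial_sum_one]
      rfl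
    rw [this, hΛ]
    refine Finset.prod_congr rfl fun v _ => ?_
    congr 1
    rw [Finsupp.finsetSum_apply, fiberCard, Fintype.card_subtype, Finset.card_filter]
    exact Finset.sum_congr rfl fun h _ => Finsupp.single_apply

/-- The interaction term `-∑ ħ^g C g m (x,…,x)/m!` at `x = ħ^{1/2} y`, as a power series
in `ħ^{1/2}` whose coefficients are polynomials in the coordinates of `y`. -/
def interaction : (MvPolynomial (Fin d) ℝ)⟦X⟧ :=
  PowerSeries.mk fun k =>
    ∑ p ∈ (Finset.range (k + 1) ×ˢ Finset.range (k + 1)).filter (fun p => 2 * p.1 + p.2 = k),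
      ((p.2.factorial : ℝ))⁻¹ • -formPoly b C p.1 p.2

/-- Each of the N factors chooses a pair (g, m) of degree 2g + m. The choices are re-indexed by the
genera, the total valence and its distribution; the degrees are then determined, and the ranges up
to K only make the sum finite. -/
theorem coeff_interaction_pow (N K : ℕ) :
    PowerSeries.coeff K (interaction b C ^ N)
      = ∑ q ∈ (Fintype.piFinset fun _ : Fin N => Finset.range (K + 1)) ×ˢ Finset.range (K + 1),
          if 2 * ∑ v, q.1 v + q.2 = K then
            ∑ m ∈ Finset.piAntidiag Finset.univ q.2,
              ∏ v, ((m v).factorial : ℝ)⁻¹ • -formPoly b C (q.1 v) (m v)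
          else 0 := by
  have h0 : interaction b C ^ N = ∏ _v : Fin N, interaction b C := by simp
  rw [h0, PowerSeries.coeff_prod]
  simp only [interaction, PowerSeries.coeff_mk, Finset.prod_univ_sum]
  rw [← Finset.sum_filter, Finset.sum_sigma', Finset.sum_sigma']
  refine Finset.sum_bij'
    (fun x _ => ⟨(fun v => (x.2 v).1, ∑ v, (x.2 v).2), fun v => (x.2 v).2⟩)
    (fun y _ => ⟨Finsupp.equivFunOnFinite.symm fun v => 2 * y.1.1 v + y.2 v,
      fun v => (y.1.1 v, y.2 v)⟩) ?_ ?_ ?_ ?_ ?_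
  · rintro ⟨κ, p⟩ h
    simp only [Finset.mem_sigma, Finset.mem_finsuppAntidiag, Finset.subset_univ, and_true,
      Fintype.mem_piFinset, Finset.mem_filter, Finset.mem_product, Finset.mem_range] at h
    obtain ⟨hκ, hp⟩ := h
    have hsum : 2 * ∑ v, (p v).1 + ∑ v, (p v).2 = K := by
      rw [← hκ, Finset.mul_sum, ← Finset.sum_add_distrib]
      exact Finset.sum_congr rfl fun v _ => (hp v).2
    simp only [Finset.mem_sigma, Finset.mem_filter, Finset.mem_product, Fintype.mem_piFinset,
      Finset.mem_range, Finset.mem_piAntidiag, hsum, and_true, Finset.mem_univ,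
      implies_true]
    refine ⟨fun v => ?_, by omega⟩
    have := Finset.single_le_sum (f := fun v => (p v).1) (fun _ _ => Nat.zero_le _)
      (Finset.mem_univ v)
    omega
  · rintro ⟨⟨γ, M⟩, m⟩ h
    simp only [Finset.mem_sigma, Finset.mem_filter, Finset.mem_product, Fintype.mem_piFinset,
      Finset.mem_range, Finset.mem_piAntidiag, Finset.mem_univ, implies_true, and_true] at h
    obtain ⟨⟨-, hK⟩, hm⟩ := h
    simp only [Finset.mem_sigma, Finset.mem_finsuppAntidiag, Finset.subset_univ, and_true,
      Fintype.mem_piFinset, Finset.mem_filter, Finset.mem_product, Finset.mem_range,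
      Finsupp.equivFunOnFinite_symm_apply_apply]
    refine ⟨?_, fun v => by omega⟩
    rw [Finset.sum_add_distrib, ← Finset.mul_sum, hm, hK]
  · rintro ⟨κ, p⟩ h
    simp only [Finset.mem_sigma, Finset.mem_finsuppAntidiag, Finset.subset_univ, and_true,
      Fintype.mem_piFinset, Finset.mem_filter, Finset.mem_product, Finset.mem_range] at h
    obtain ⟨hκ, hp⟩ := h
    obtain rfl : (Finsupp.equivFunOnFinite.symm fun v => 2 * (p v).1 + (p v).2) = κ :=
      Finsupp.ext fun v => (hp v).2
    rfl
  · rintro ⟨⟨γ, M⟩, m⟩ h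
    simp only [Finset.mem_sigma, Finset.mem_piAntidiag] at h
    obtain rfl := h.2.1
    rfl
  · intro x _
    rfl

/-- The sum over attachments in terms of the interaction. -/
theorem sum_attachments_formPoly {N : ℕ} (M : ℕ) (γ : Fin N → ℕ) :
    ((M.factorial : ℝ))⁻¹ • ∑ ρ : Fin M → Fin N, ∏ v, -formPoly b C (γ v) (fiberCard ρ v)
      = ∑ m ∈ Finset.piAntidiag Finset.univ M,
          ∏ v, ((m v).factorial : ℝ)⁻¹ • -formPoly b C (γ v) (m v) := by
  rw [sum_attachments M fun v k => -formPoly b C (γ v) k, Finset.smul_sum]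
  refine Finset.sum_congr rfl fun m hm => ?_
  rw [Finset.mem_piAntidiag] at hm
  have hspec := Nat.multinomial_spec Finset.univ m
  rw [hm.1] at hspec
  have h1 : (M.factorial : ℝ)⁻¹ * Nat.multinomial Finset.univ m
      = ∏ v, ((m v).factorial : ℝ)⁻¹ := by
    rw [Finset.prod_inv_distrib, ← hspec]
    push_cast
    have h2 : (Nat.multinomial Finset.univ m : ℝ) ≠ 0 :=
      Nat.cast_ne_zero.2 (Nat.multinomial_pos Finset.univ m).ne'
    have h3 : ∏ v, ((m v).factorial : ℝ) ≠ 0 := Finset.prod_ne_zero_iff.2 fun v _ => by positivity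
    field_simp
  rw [Finset.prod_smul, ← h1, mul_smul, ← nsmul_eq_mul, Nat.cast_smul_eq_nsmul]

end Polynomials

/-! ### Summation over labelled graphs -/

section Labelled

variable {d : ℕ} {V : Type*} [AddCommGroup V] [Module ℝ V]
  (b : Module.Basis (Fin d) ℝ V) (B : LinearMap.BilinForm ℝ V)
  (C : ∀ _g m : ℕ, MultilinearMap ℝ (fun _ : Fin m => V) ℝ)

/-- The contribution of a graph to the coefficient of `ħ^{k/2}`, without the symmetry factor. -/
def contribution (k : ℤ) (Γ : GenusGraph) : ℝ :=
  if 2 * -Γ.eulerChar = k then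
    (2 * Real.pi) ^ ((d : ℝ) / 2) / Real.sqrt (gram b B).det * amplitude b B C Γ
  else 0

/-- The coefficient of `ħ^{k/2}` in the `N`-th power of the interaction divided by `ħ`. -/
def interactionCoeff (k : ℤ) (N : ℕ) : MvPolynomial (Fin d) ℝ :=
  if 0 ≤ k + 2 * N then PowerSeries.coeff (k + 2 * N).toNat (interaction b C ^ N) else 0

/-- The data of a graph with `N` numbered vertices, apart from `N`. -/
abbrev GraphData (N : ℕ) : Type :=
  Σ q : (Fin N → ℕ) × ℕ, (Fin q.2 → Fin N) × Gluing q.2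

/-- The graph with the given data. -/
def GraphData.graph {N : ℕ} (x : GraphData N) : GenusGraph := mkGraph x.1.1 x.2.1 x.2.2

/-- Graphs with numbered vertices and half-edges, sorted by the number of vertices. -/
def graphDataEquiv : (Σ N, GraphData N) ≃ GenusGraph where
  toFun x := x.2.graph
  invFun Γ := ⟨Γ.nV, ⟨(Γ.genus, Γ.nH), (Γ.root, ⟨Γ.opp, Γ.opp_opp, Γ.opp_ne⟩)⟩⟩
  left_inv _ := rfl
  right_inv _ := rfl

theorem two_mul_neg_eulerChar_mkGraph {N M : ℕ} (γ : Fin N → ℕ) (ρ : Fin M → Fin N)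
    (o : Gluing M) :
    2 * -(mkGraph γ ρ o).eulerChar = 2 * (∑ v, γ v : ℕ) - 2 * N + M := by
  rw [GenusGraph.two_mul_neg_eulerChar]
  push_cast
  rfl

/-- For a fixed number of vertices the exponent condition bounds the genera and the number of
half-edges, so the sum is finite. Gluings are summed by Wick, attachments by the multinomial
identity, and the rest is a coefficient of the N-th power. -/
theorem hasSum_graphData (hG : (gram b B).PosDef) (k : ℤ) (N : ℕ) :
    HasSum (fun x : GraphData N =>
        contribution b B C k x.graph / (x.graph.nV.factorial * x.graph.nH.factorial))
      ((N.factorial : ℝ)⁻¹ * gaussE b B hG (interactionCoeff b C k N)) := by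
  classical
  set K := (k + 2 * N).toNat with hK
  set Q := (Fintype.piFinset fun _ : Fin N => Finset.range (K + 1)) ×ˢ Finset.range (K + 1)
  have hzero : ∀ x ∉ Q.sigma fun _ => Finset.univ,
      contribution b B C k (GraphData.graph x) /
        ((GraphData.graph x).nV.factorial * (GraphData.graph x).nH.factorial) = 0 := by
    rintro ⟨⟨γ, M⟩, ρ, o⟩ hx
    rw [contribution, if_neg, zero_div]
    intro h
    rw [GraphData.graph, two_mul_neg_eulerChar_mkGraph] at h
    dsimp only at h
    apply hx
    simp only [Q, Finset.mem_sigma, Finset.mem_univ, and_true, Finset.mem_product,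
      Fintype.mem_piFinset, Finset.mem_range]
    refine ⟨fun v => ?_, by omega⟩
    have := Finset.single_le_sum (f := γ) (fun _ _ => Nat.zero_le _) (Finset.mem_univ v)
    omega
  have hinner : ∀ q : (Fin N → ℕ) × ℕ, ∑ s : (Fin q.2 → Fin N) × Gluing q.2,
      contribution b B C k (mkGraph q.1 s.1 s.2) / (N.factorial * q.2.factorial)
        = if 2 * (∑ v, q.1 v : ℕ) - 2 * (N : ℤ) + q.2 = k then
            (N.factorial : ℝ)⁻¹ * gaussE b B hG (∑ m ∈ Finset.piAntidiag Finset.univ q.2,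
              ∏ v, ((m v).factorial : ℝ)⁻¹ • -formPoly b C (q.1 v) (m v))
          else 0 := by
    rintro ⟨γ, M⟩
    simp only [contribution, two_mul_neg_eulerChar_mkGraph]
    split_ifs with h
    · rw [Fintype.sum_prod_type]
      simp only [← Finset.sum_div]
      rw [Finset.sum_congr rfl fun ρ _ => sum_gluing_amplitude b B C γ ρ hG, ← map_sum,
        ← sum_attachments_formPoly, map_smul, smul_eq_mul]
      field_simp
    · simp
  have hs := hasSum_sum_of_ne_finset_zero (L := SummationFilter.unconditional _) hzero
  rw [Finset.sum_sigma] at hs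
  have hval : (N.factorial : ℝ)⁻¹ * gaussE b B hG (interactionCoeff b C k N)
      = ∑ q ∈ Q, if 2 * (∑ v, q.1 v : ℕ) - 2 * (N : ℤ) + q.2 = k then
            (N.factorial : ℝ)⁻¹ * gaussE b B hG (∑ m ∈ Finset.piAntidiag Finset.univ q.2,
              ∏ v, ((m v).factorial : ℝ)⁻¹ • -formPoly b C (q.1 v) (m v))
          else 0 := by
    rw [interactionCoeff]
    split_ifs with h
    · rw [coeff_interaction_pow, map_sum, Finset.mul_sum]
      refine Finset.sum_congr rfl fun q _ => ?_
      have hiff : 2 * ∑ v, q.1 v + q.2 = (k + 2 * N).toNat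
          ↔ 2 * (∑ v, q.1 v : ℕ) - 2 * (N : ℤ) + q.2 = k := by omega
      simp only [hiff]
      split_ifs <;> simp
    · rw [map_zero, mul_zero]
      refine (Finset.sum_eq_zero fun q _ => if_neg ?_).symm
      omega
  rw [hval, ← Finset.sum_congr rfl fun q _ => hinner q]
  exact hs

/-- At a contributing vertex 2g + m - 2 is nonnegative, and it is zero only for g = 1, m = 0. -/
theorem vertexValue_ne_zero (h00 : C 0 0 = 0) (h01 : C 0 1 = 0) (h02 : C 0 2 = 0)
    {Γ : GenusGraph} {v : Fin Γ.nV} {x : Fin Γ.nH → V} (h : vertexValue C Γ v x ≠ 0) :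
    2 ≤ 2 * Γ.genus v + Γ.valence v ∧
      (Γ.valence v ≠ 0 → 3 ≤ 2 * Γ.genus v + Γ.valence v) := by
  by_contra hcon
  have hC : C (Γ.genus v) (Γ.valence v) = 0 := by
    have hg : Γ.genus v = 0 := by omega
    have hm : Γ.valence v = 0 ∨ Γ.valence v = 1 ∨ Γ.valence v = 2 := by omega
    rcases hm with hm | hm | hm <;> rw [hg, hm] <;> assumption
  apply h
  rw [vertexValue, hC]
  simp

/-- Graphs that contribute to the coefficient of `ħ^{k/2}` have few half-edges and small genera. -/
theorem contribution_ne_zero (h00 : C 0 0 = 0) (h01 : C 0 1 = 0) (h02 : C 0 2 = 0)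
    {k : ℤ} {Γ : GenusGraph} (h : contribution b B C k Γ ≠ 0) :
    Γ.nH ≤ 3 * k.toNat ∧ ∀ v, Γ.genus v ≤ k.toNat + 2 ∧ Γ.valence v ≤ k.toNat + 2 := by
  have hk : 2 * -Γ.eulerChar = k := by
    by_contra h'
    exact h (if_neg h')
  rw [contribution, if_pos hk] at h
  obtain ⟨l, -, hl⟩ := Finset.exists_ne_zero_of_sum_ne_zero (right_ne_zero_of_mul h)
  have hv : ∀ v, _ := fun v => vertexValue_ne_zero C h00 h01 h02
    (Finset.prod_ne_zero_iff.1 (left_ne_zero_of_mul hl) v (Finset.mem_univ v))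
  -- The share of a vertex in the exponent of ħ^{1/2}; the shares add up to k.
  set w : Fin Γ.nV → ℕ := fun v => 2 * Γ.genus v + Γ.valence v - 2 with hw
  have hwv : ∀ v, w v + 2 = 2 * Γ.genus v + Γ.valence v := fun v => Nat.sub_add_cancel (hv v).1
  have hsum : ∑ v, w v = k.toNat := by
    have h1 : ∑ v, (w v + 2) = ∑ v, (2 * Γ.genus v + Γ.valence v) :=
      Finset.sum_congr rfl fun v _ => hwv v
    rw [Finset.sum_add_distrib, Finset.sum_add_distrib, ← Finset.mul_sum, Γ.sum_valence,
      Finset.sum_const, Finset.card_univ, Fintype.card_fin, smul_eq_mul] at h1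
    have h2 := Γ.two_mul_neg_eulerChar
    have h3 : ((∑ v, Γ.genus v : ℕ) : ℤ) = ∑ v, (Γ.genus v : ℤ) := by push_cast; rfl
    rw [← h3, hk] at h2
    omega
  constructor
  -- A vertex with half-edges has w ≥ 1, so its valence is at most w + 2 ≤ 3w.
  · rw [← Γ.sum_valence, ← hsum, Finset.mul_sum]
    refine Finset.sum_le_sum fun v _ => ?_
    have := hv v
    have := hwv v
    omega
  · intro v
    have h1 := Finset.single_le_sum (f := w) (fun _ _ => Nat.zero_le _) (Finset.mem_univ v)
    have h2 := hwv v
    omega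

theorem abs_vertexValue_le {Γ : GenusGraph} {v : Fin Γ.nV} {x : Fin Γ.nH → V} {K : ℝ}
    (hK : ∀ e : Fin (Γ.valence v) ≃ Γ.HalfEdgesAt v,
      |C (Γ.genus v) (Γ.valence v) fun j => x (e j).1| ≤ K) : |vertexValue C Γ v x| ≤ K := by
  have hcard : Fintype.card (Fin (Γ.valence v) ≃ Γ.HalfEdgesAt v) = (Γ.valence v).factorial := by
    rw [Fintype.card_equiv (Fintype.equivFinOfCardEq (n := Γ.valence v) rfl).symm,
      Fintype.card_fin]
  have hpos : (0 : ℝ) < (Γ.valence v).factorial := by positivity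
  rw [vertexValue, abs_mul, abs_inv, abs_of_pos hpos, inv_mul_le_iff₀ hpos]
  refine (Finset.abs_sum_le_sum_abs _ _).trans ?_
  simp only [abs_neg]
  refine (Finset.sum_le_sum fun e _ => hK e).trans ?_
  rw [Finset.sum_const, Finset.card_univ, hcard, nsmul_eq_mul]

/-- Genera and valences are bounded in terms of k, so only finitely many tensor coefficients occur.
The numbers of labellings and of edge factors are bounded too, and only the product over vertices
grows with the graph. -/
theorem exists_abs_contribution_le (h00 : C 0 0 = 0) (h01 : C 0 1 = 0) (h02 : C 0 2 = 0)
    (k : ℤ) : ∃ D E : ℝ, 0 ≤ D ∧ 0 ≤ E ∧ ∀ Γ, |contribution b B C k Γ| ≤ D * E ^ Γ.nV := by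
  set n := k.toNat + 3 with hn
  set K : ℝ := ∑ g ∈ Finset.range n, ∑ m ∈ Finset.range n, ∑ l : Fin m → Fin d,
    |C g m fun j => b (l j)| with hK
  have hK0 : 0 ≤ K := Finset.sum_nonneg fun g _ => Finset.sum_nonneg fun m _ =>
    Finset.sum_nonneg fun l _ => abs_nonneg _
  have hKle : ∀ g < n, ∀ m < n, ∀ l : Fin m → Fin d, |C g m fun j => b (l j)| ≤ K := by
    intro g hg m hm l
    refine le_trans ?_ (Finset.single_le_sum (f := fun g => ∑ m ∈ Finset.range n,
      ∑ l : Fin m → Fin d, |C g m fun j => b (l j)|) (fun g _ => Finset.sum_nonneg fun m _ =>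
        Finset.sum_nonneg fun l _ => abs_nonneg _) (Finset.mem_range.2 hg))
    refine le_trans ?_ (Finset.single_le_sum (f := fun m =>
      ∑ l : Fin m → Fin d, |C g m fun j => b (l j)|) (fun m _ =>
        Finset.sum_nonneg fun l _ => abs_nonneg _) (Finset.mem_range.2 hm))
    exact Finset.single_le_sum (f := fun l : Fin m → Fin d => |C g m fun j => b (l j)|)
      (fun l _ => abs_nonneg _) (Finset.mem_univ l)
  -- The summand 1 ensures A ≥ 1, so exponents may be raised to P; the base d + 1 below serves the
  -- same end.
  set A : ℝ := 1 + ∑ i, ∑ j, |(gram b B)⁻¹ i j| with hA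
  have hA1 : 1 ≤ A := le_add_of_nonneg_right (Finset.sum_nonneg fun i _ =>
    Finset.sum_nonneg fun j _ => abs_nonneg _)
  have hAle : ∀ i j, |(gram b B)⁻¹ i j| ≤ A := by
    intro i j
    have h1 := Finset.single_le_sum (f := fun j => |(gram b B)⁻¹ i j|)
      (fun _ _ => abs_nonneg _) (Finset.mem_univ j)
    have h2 := Finset.single_le_sum (f := fun i => ∑ j, |(gram b B)⁻¹ i j|)
      (fun _ _ => Finset.sum_nonneg fun _ _ => abs_nonneg _) (Finset.mem_univ i)
    linarith
  set κ : ℝ := (2 * Real.pi) ^ ((d : ℝ) / 2) / Real.sqrt (gram b B).det with hκ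
  set P := 3 * k.toNat with hP
  refine ⟨|κ| * ((d + 1) ^ P * A ^ P), K, by positivity, hK0, fun Γ => ?_⟩
  by_cases h : contribution b B C k Γ = 0
  · rw [h, abs_zero]
    positivity
  obtain ⟨hH, hv⟩ := contribution_ne_zero b B C h00 h01 h02 h
  have hterm : ∀ l : Fin Γ.nH → Fin d, |(∏ v, vertexValue C Γ v fun h => b (l h)) *
      ∏ h ∈ Γ.edges, (gram b B)⁻¹ (l h) (l (Γ.opp h))| ≤ K ^ Γ.nV * A ^ P := by
    intro l
    rw [abs_mul, Finset.abs_prod, Finset.abs_prod]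
    refine mul_le_mul ?_ ?_ (Finset.prod_nonneg fun _ _ => abs_nonneg _) (by positivity)
    · refine (Finset.prod_le_prod (fun _ _ => abs_nonneg _) fun v _ =>
        abs_vertexValue_le C (K := K) fun e => ?_).trans_eq (by simp)
      have := hv v
      exact hKle _ (by omega) _ (by omega) fun j => l (e j).1
    · refine (Finset.prod_le_prod (fun _ _ => abs_nonneg _) fun h _ => hAle _ _).trans ?_
      rw [Finset.prod_const]
      refine pow_le_pow_right₀ hA1 ?_
      have := Γ.two_mul_card_edges
      omega
  have hamp : |amplitude b B C Γ| ≤ (d + 1) ^ P * (K ^ Γ.nV * A ^ P) := by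
    rw [amplitude]
    refine (Finset.abs_sum_le_sum_abs _ _).trans ((Finset.sum_le_sum fun l _ => hterm l).trans ?_)
    rw [Finset.sum_const, Finset.card_univ, Fintype.card_fun, Fintype.card_fin, Fintype.card_fin,
      nsmul_eq_mul]
    refine mul_le_mul_of_nonneg_right ?_ (by positivity)
    push_cast
    have hd1 : (1 : ℝ) ≤ d + 1 := le_add_of_nonneg_left d.cast_nonneg
    calc (d : ℝ) ^ Γ.nH ≤ (d + 1) ^ Γ.nH := by gcongr; linarith
      _ ≤ (d + 1) ^ P := pow_le_pow_right₀ hd1 hH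
  rw [contribution]
  split_ifs
  · rw [abs_mul]
    calc |κ| * |amplitude b B C Γ| ≤ |κ| * ((d + 1) ^ P * (K ^ Γ.nV * A ^ P)) := by gcongr
      _ = _ := by ring
  · rw [abs_zero]
    positivity

/-- Both the number of relevant graphs with N vertices and their contributions are at most
exponential in N, so the exponential series is a majorant. -/
theorem summable_contribution (h00 : C 0 0 = 0) (h01 : C 0 1 = 0) (h02 : C 0 2 = 0)
    (k : ℤ) : Summable fun x : Σ N, GraphData N =>
      contribution b B C k x.2.graph / (x.2.graph.nV.factorial * x.2.graph.nH.factorial) := by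
  classical
  obtain ⟨D, E, hD, hE, hbound⟩ := exists_abs_contribution_le b B C h00 h01 h02 k
  set f : (Σ N, GraphData N) → ℝ := fun x =>
    contribution b B C k x.2.graph / (x.2.graph.nV.factorial * x.2.graph.nH.factorial) with hf
  set n := k.toNat + 3 with hn
  set P := 3 * k.toNat with hP
  let S : ∀ N, Finset (GraphData N) := fun N =>
    ((Fintype.piFinset fun _ : Fin N => Finset.range n) ×ˢ Finset.range (P + 1)).sigma
      fun _ => Finset.univ
  have hS : ∀ N, ∀ x ∉ S N, |f ⟨N, x⟩| = 0 := by
    intro N x hx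
    rw [abs_eq_zero, hf]
    dsimp only
    by_contra h
    have h' : contribution b B C k (GraphData.graph x) ≠ 0 := fun e => h (by rw [e, zero_div])
    obtain ⟨hH, hv⟩ := contribution_ne_zero b B C h00 h01 h02 h'
    apply hx
    simp only [S, Finset.mem_sigma, Finset.mem_univ, and_true, Finset.mem_product,
      Fintype.mem_piFinset, Finset.mem_range]
    exact ⟨fun v => Nat.lt_succ_of_le (hv v).1, Nat.lt_succ_of_le hH⟩
  set G : ℕ := ∑ M ∈ Finset.range (P + 1), Fintype.card (Gluing M) with hG
  -- The attachments number N^M with M ≤ P; the crude bound N ≤ 2^N makes this exponential in N.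
  have hcard : ∀ N, ((S N).card : ℝ) ≤ ((P + 1) * G) * (n * 2 ^ P : ℝ) ^ N := by
    intro N
    have h1 : (S N).card ≤ n ^ N * (P + 1) * ((2 ^ N) ^ P * G) := by
      rw [Finset.card_sigma]
      refine (Finset.sum_le_card_nsmul _ _ ((2 ^ N) ^ P * G) fun q hq => ?_).trans_eq ?_
      · have hq2 := (Finset.mem_product.1 hq).2
        rw [Finset.card_univ, Fintype.card_prod, Fintype.card_fun, Fintype.card_fin,
          Fintype.card_fin]
        refine Nat.mul_le_mul ?_ (Finset.single_le_sum
          (f := fun M => Fintype.card (Gluing M)) (fun _ _ => Nat.zero_le _) hq2)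
        exact (Nat.pow_le_pow_left Nat.lt_two_pow_self.le _).trans
          (Nat.pow_le_pow_right (by positivity) (Nat.lt_succ_iff.1 (Finset.mem_range.1 hq2)))
      · rw [Finset.card_product, Fintype.card_piFinset_const, Finset.card_range,
          Finset.card_range, smul_eq_mul]
    refine (Nat.cast_le.2 h1).trans_eq ?_
    push_cast
    rw [mul_pow, ← pow_mul, ← pow_mul, mul_comm N P]
    ring
  have habs : Summable fun x => |f x| := by
    rw [summable_sigma_of_nonneg fun _ => abs_nonneg _]
    refine ⟨fun N => summable_of_ne_finset_zero (s := S N) (hS N), ?_⟩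
    refine Summable.of_nonneg_of_le (fun N => tsum_nonneg fun _ => abs_nonneg _) (fun N => ?_)
      ((Real.summable_pow_div_factorial (n * 2 ^ P * E)).mul_left ((P + 1) * G * D))
    rw [tsum_eq_sum (s := S N) (fun x hx => hS N x hx)]
    have hx : ∀ x ∈ S N, |f ⟨N, x⟩| ≤ D * E ^ N / N.factorial := by
      intro x _
      rw [hf]
      dsimp only
      rw [abs_div, abs_of_pos (a := (_ : ℝ) * _) (by positivity)]
      refine div_le_div₀ (by positivity) (hbound _) (by positivity) ?_
      refine le_mul_of_one_le_right (by positivity) ?_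
      exact_mod_cast Nat.succ_le_of_lt (Nat.factorial_pos _)
    refine (Finset.sum_le_card_nsmul _ _ _ hx).trans ?_
    rw [nsmul_eq_mul]
    refine (mul_le_mul_of_nonneg_right (hcard N) (by positivity)).trans_eq ?_
    rw [mul_pow]
    ring
  exact habs.of_abs

end Labelled

/-! ### The formal integral -/

section Integral

variable {d : ℕ} {V : Type*} [AddCommGroup V] [Module ℝ V]
  (b : Module.Basis (Fin d) ℝ V) (B : LinearMap.BilinForm ℝ V)
  (C : ∀ _g m : ℕ, MultilinearMap ℝ (fun _ : Fin m => V) ℝ)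

/-- The interaction divided by `ħ`. -/
def reducedInteraction : (MvPolynomial (Fin d) ℝ)⟦X⟧ :=
  PowerSeries.mk fun k => PowerSeries.coeff (k + 2) (interaction b C)

/-- The positive-degree part of the interaction divided by `ħ`. -/
def positiveInteraction : (MvPolynomial (Fin d) ℝ)⟦X⟧ :=
  reducedInteraction b C - PowerSeries.C (PowerSeries.coeff 0 (reducedInteraction b C))

theorem interaction_eq (h00 : C 0 0 = 0) (h01 : C 0 1 = 0) :
    interaction b C = PowerSeries.X ^ 2 * reducedInteraction b C := by
  ext1 k
  rw [PowerSeries.coeff_X_pow_mul']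
  split_ifs with h
  · rw [reducedInteraction, PowerSeries.coeff_mk, Nat.sub_add_cancel h]
  · have h' : k = 0 ∨ k = 1 := by omega
    rcases h' with rfl | rfl
    · simp [interaction, formPoly, h00, Finset.sum_filter, Finset.sum_product,
        Finset.sum_range_succ]
    · simp [interaction, formPoly, h01, Finset.sum_filter, Finset.sum_product,
        Finset.sum_range_succ]

/-- In degree 2 only (g, m) = (0, 2) and (1, 0) occur. The first vanishes and the second does not
depend on the point. -/
theorem coeff_zero_reducedInteraction (h02 : C 0 2 = 0) :
    PowerSeries.coeff 0 (reducedInteraction b C) = MvPolynomial.C (-(C 1 0 fun _ => 0)) := by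
  rw [reducedInteraction, PowerSeries.coeff_mk, interaction, PowerSeries.coeff_mk,
    Finset.sum_filter, Finset.sum_product]
  simp only [Finset.sum_range_succ, Finset.sum_range_zero]
  have h : ∀ y : Fin 0 → V, C 1 0 y = C 1 0 fun _ => 0 :=
    fun y => congrArg _ (Subsingleton.elim _ _)
  simp [formPoly, h02, h]

theorem interactionCoeff_of_nonneg (h00 : C 0 0 = 0) (h01 : C 0 1 = 0) (k N : ℕ) :
    interactionCoeff b C k N = PowerSeries.coeff k (reducedInteraction b C ^ N) := by
  have h : ((k : ℤ) + 2 * N).toNat = k + 2 * N := by omega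
  rw [interactionCoeff, if_pos (by positivity), h, interaction_eq b C h00 h01, mul_pow, ← pow_mul,
    PowerSeries.coeff_X_pow_mul]

theorem interactionCoeff_of_neg (h00 : C 0 0 = 0) (h01 : C 0 1 = 0) {k : ℤ} (hk : k < 0) (N : ℕ) :
    interactionCoeff b C k N = 0 := by
  rw [interactionCoeff]
  split_ifs with h
  · rw [interaction_eq b C h00 h01, mul_pow, ← pow_mul, PowerSeries.coeff_X_pow_mul', if_neg]
    omega
  · rfl

theorem coeff_pow_eq_zero {R : Type*} [CommRing R] {A : R⟦X⟧} (hA : PowerSeries.coeff 0 A = 0)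
    {k j : ℕ} (h : k < j) : PowerSeries.coeff k (A ^ j) = 0 := by
  rw [PowerSeries.coeff_zero_eq_constantCoeff, ← PowerSeries.X_dvd_iff] at hA
  exact PowerSeries.X_pow_dvd_iff.1 (pow_dvd_pow_of_dvd hA j) k h

theorem coeff_zero_positiveInteraction :
    PowerSeries.coeff 0 (positiveInteraction b C) = 0 := by
  simp [positiveInteraction]

/-- The j-th power of a series without constant term starts in degree j, so only j ≤ k matter. -/
theorem coeff_formalExp (A : ℝ⟦X⟧) (k : ℕ) :
    PowerSeries.coeff k (formalExp A) = Real.exp (PowerSeries.constantCoeff A) *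
      ∑ j ∈ Finset.range (k + 1), (j.factorial : ℝ)⁻¹ *
        PowerSeries.coeff k ((A - PowerSeries.C (PowerSeries.constantCoeff A)) ^ j) := by
  have h0 : PowerSeries.constantCoeff (A - PowerSeries.C (PowerSeries.constantCoeff A)) = 0 := by
    simp
  rw [formalExp, PowerSeries.coeff_C_mul,
    PowerSeries.coeff_subst' (PowerSeries.HasSubst.of_constantCoeff_zero' h0)]
  congr 1
  rw [finsum_eq_sum_of_support_subset (s := Finset.range (k + 1))]
  · refine Finset.sum_congr rfl fun j _ => ?_
    rw [PowerSeries.coeff_exp, smul_eq_mul]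
    simp
  · intro j hj
    rw [Finset.coe_range, Set.mem_Iio]
    by_contra h
    refine hj ?_
    change _ • PowerSeries.coeff k (_ ^ j) = 0
    rw [coeff_pow_eq_zero (k := k) (j := j)
      ((PowerSeries.coeff_zero_eq_constantCoeff_apply _).trans h0) (by omega), smul_zero]

theorem coeff_exponentSeries_succ (c : Fin d → ℝ) (k : ℕ) :
    PowerSeries.coeff (k + 1) (exponentSeries B C (point b c))
      = MvPolynomial.eval c (PowerSeries.coeff (k + 1) (reducedInteraction b C)) := by
  rw [exponentSeries, PowerSeries.coeff_mk, actionSeries, map_add, PowerSeries.coeff_monomial,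
    if_neg (by omega), zero_add, PowerSeries.coeff_mk, reducedInteraction, PowerSeries.coeff_mk,
    interaction, PowerSeries.coeff_mk, map_sum, ← Finset.sum_neg_distrib]
  refine Finset.sum_congr rfl fun p _ => ?_
  rw [MvPolynomial.smul_eval, map_neg, eval_formPoly]
  ring

theorem constantCoeff_exponentSeries (h02 : C 0 2 = 0) (c : Fin d → ℝ) :
    PowerSeries.constantCoeff (exponentSeries B C (point b c))
      = -(B (point b c) (point b c)) / 2 + -(C 1 0 fun _ => 0) := by
  rw [← PowerSeries.coeff_zero_eq_constantCoeff_apply, exponentSeries, PowerSeries.coeff_mk,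
    actionSeries, map_add, PowerSeries.coeff_monomial, PowerSeries.coeff_mk, Finset.sum_filter,
    Finset.sum_product]
  simp only [Finset.sum_range_succ, Finset.sum_range_zero]
  have h : (fun _ => point b c : Fin 0 → V) = fun _ => 0 := Subsingleton.elim _ _
  simp [h02, h]
  ring

theorem exponentSeries_sub_const (c : Fin d → ℝ) :
    exponentSeries B C (point b c) -
        PowerSeries.C (PowerSeries.constantCoeff (exponentSeries B C (point b c)))
      = PowerSeries.map (MvPolynomial.eval c) (positiveInteraction b C) := by
  ext1 k
  rw [PowerSeries.coeff_map]
  cases k with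
  | zero => rw [coeff_zero_positiveInteraction]; simp
  | succ k =>
    rw [map_sub, positiveInteraction, map_sub, PowerSeries.coeff_C, if_neg k.succ_ne_zero,
      PowerSeries.coeff_C, if_neg k.succ_ne_zero, sub_zero, sub_zero, coeff_exponentSeries_succ]

/-- The polynomial factor in the coefficients of the integrand. -/
def integrandPoly (k : ℕ) : MvPolynomial (Fin d) ℝ :=
  ∑ j ∈ Finset.range (k + 1),
    (Real.exp (-(C 1 0 fun _ => 0)) * (j.factorial : ℝ)⁻¹) •
      PowerSeries.coeff k (positiveInteraction b C ^ j)

/-- The quadratic form sits only in the constant term of the exponent and comes out as the Gaussian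
weight; all else is polynomial. Absolute convergence of the integrals follows. -/
theorem coeff_integrand (h02 : C 0 2 = 0) (k : ℕ) (c : Fin d → ℝ) :
    PowerSeries.coeff k (formalExp (exponentSeries B C (point b c)))
      = MvPolynomial.eval c (integrandPoly b C k) *
          Real.exp (-(B (point b c) (point b c)) / 2) := by
  rw [coeff_formalExp, exponentSeries_sub_const, constantCoeff_exponentSeries b B C h02,
    Real.exp_add, integrandPoly, map_sum, mul_assoc, mul_comm, Finset.mul_sum]
  congr 1
  refine Finset.sum_congr rfl fun j _ => ?_
  rw [MvPolynomial.smul_eval, ← map_pow, PowerSeries.coeff_map]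
  ring

/-- Expansion of the exponential of a sum of a constant and a series without constant term. -/
theorem hasSum_coeff_reducedInteraction (hG : (gram b B).PosDef) (h02 : C 0 2 = 0) (k : ℕ) :
    HasSum (fun N : ℕ => (N.factorial : ℝ)⁻¹ *
        gaussE b B hG (PowerSeries.coeff k (reducedInteraction b C ^ N)))
      (gaussE b B hG (integrandPoly b C k)) := by
  set a : ℝ := -(C 1 0 fun _ => 0) with ha
  set e : ℕ → ℝ := fun j => gaussE b B hG (PowerSeries.coeff k (positiveInteraction b C ^ j))
    with he
  have hsplit : reducedInteraction b C
      = positiveInteraction b C + PowerSeries.C (MvPolynomial.C a) := by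
    rw [positiveInteraction, coeff_zero_reducedInteraction b C h02, sub_add_cancel]
  -- Here j counts the nonconstant factors among the N. As binom(N, j)/N! = 1/(j!(N-j)!), the shift
  -- N = n + j leaves the series of e^a.
  have hexp : ∀ j : ℕ, HasSum (fun N : ℕ => if j ≤ N then
      (N.factorial : ℝ)⁻¹ * (a ^ (N - j) * N.choose j) * e j else 0)
      (Real.exp a * (j.factorial : ℝ)⁻¹ * e j) := by
    intro j
    have h1 : HasSum (fun n : ℕ => a ^ n / n.factorial) (Real.exp a) := by
      rw [Real.exp_eq_exp_ℝ]
      exact NormedSpace.expSeries_div_hasSum_exp a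
    have h2 := h1.mul_right ((j.factorial : ℝ)⁻¹ * e j)
    rw [← mul_assoc] at h2
    rw [← (add_left_injective j).hasSum_iff]
    · have h6 : ((fun N : ℕ => if j ≤ N then (N.factorial : ℝ)⁻¹ * (a ^ (N - j) * N.choose j) * e j
          else 0) ∘ fun n => n + j) = fun n => a ^ n / n.factorial * ((j.factorial : ℝ)⁻¹ * e j) := by
        funext n
        simp only [Function.comp_apply, Nat.le_add_left, if_true, Nat.add_sub_cancel]
        have h3 := Nat.add_choose_mul_factorial_mul_factorial n j
        have h4 : (((n + j).choose j : ℕ) : ℝ) * n.factorial * j.factorial = (n + j).factorial := by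
          exact_mod_cast h3
        rw [← h4]
        have h5 : (((n + j).choose j : ℕ) : ℝ) ≠ 0 :=
          Nat.cast_ne_zero.2 (Nat.choose_pos (Nat.le_add_left j n)).ne'
        field_simp
      rw [h6]
      exact h2
    · intro N hN
      exact if_neg fun h => hN ⟨N - j, Nat.sub_add_cancel h⟩
  have hsum := hasSum_sum (s := Finset.range (k + 1)) fun j _ => hexp j
  have hval : gaussE b B hG (integrandPoly b C k)
      = ∑ j ∈ Finset.range (k + 1), Real.exp a * (j.factorial : ℝ)⁻¹ * e j := by
    rw [integrandPoly, map_sum]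
    exact Finset.sum_congr rfl fun j _ => by rw [map_smul, smul_eq_mul]
  rw [hval]
  convert hsum using 1
  funext N
  have hbin : PowerSeries.coeff k (reducedInteraction b C ^ N)
      = ∑ j ∈ Finset.range (N + 1), (a ^ (N - j) * N.choose j) •
          PowerSeries.coeff k (positiveInteraction b C ^ j) := by
    rw [hsplit, add_pow, map_sum]
    refine Finset.sum_congr rfl fun j _ => ?_
    rw [← map_pow, ← map_pow, mul_assoc, ← map_natCast (PowerSeries.C (R := MvPolynomial (Fin d) ℝ)),
      ← map_mul, PowerSeries.coeff_mul_C, MvPolynomial.smul_eq_C_mul, map_mul, map_natCast,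
      mul_comm]
  rw [hbin, map_sum, Finset.mul_sum, ← Finset.sum_filter]
  -- Powers j > k have no coefficient in degree k, so the range of j does not grow with N and a
  -- finite sum of convergent series suffices.
  have h1 : ∀ j ∈ Finset.range (N + 1), j ∉ (Finset.range (k + 1)).filter (fun j => j ≤ N) →
      (N.factorial : ℝ)⁻¹ * gaussE b B hG ((a ^ (N - j) * N.choose j) •
          PowerSeries.coeff k (positiveInteraction b C ^ j)) = 0 := by
    intro j hj hj'
    rw [coeff_pow_eq_zero (coeff_zero_positiveInteraction b C), smul_zero, map_zero, mul_zero]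
    simp only [Finset.mem_filter, Finset.mem_range] at hj hj'
    omega
  rw [← Finset.sum_subset (fun j hj => ?_) h1]
  · refine Finset.sum_congr rfl fun j _ => ?_
    rw [map_smul, smul_eq_mul, mul_assoc (N.factorial : ℝ)⁻¹]
  · simp only [Finset.mem_filter, Finset.mem_range] at hj ⊢
    omega

end Integral

end Feynman

end

theorem mainTheorem3 {d : ℕ} {V : Type*} [AddCommGroup V] [Module ℝ V]
    (b : Module.Basis (Fin d) ℝ V) (B : LinearMap.BilinForm ℝ V)
    (hsymm : ∀ x y, B x y = B y x) (hpos : ∀ x, x ≠ 0 → 0 < B x x)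
    (C : ∀ _g m : ℕ, MultilinearMap ℝ (fun _ : Fin m => V) ℝ)
    (h00 : C 0 0 = 0) (h01 : C 0 1 = 0) (h02 : C 0 2 = 0) :
    (∀ k : ℕ, MeasureTheory.Integrable fun c : Fin d → ℝ =>
      PowerSeries.coeff k
        (Feynman.formalExp (Feynman.exponentSeries B C (Feynman.point b c)))) ∧
    ∀ k : ℤ, HasSum
      (fun Γ : Σ n : ℕ →₀ ℕ, Feynman.GraphsWithValences n =>
        (2 * Real.pi) ^ ((d : ℝ) / 2) / Real.sqrt (Feynman.gram b B).det *
          (Feynman.graphTerm b B C Γ.2.1.rep).coeff k)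
      ((Feynman.formalIntegral b B C : LaurentSeries ℝ).coeff k) := by
  have hG := Feynman.gram_posDef b B hsymm hpos
  refine ⟨fun k => ?_, fun k => ?_⟩
  · simp only [Feynman.coeff_integrand b B C h02]
    exact Feynman.integrable_eval_mul_exp_form b B hG _
  have hlabelled : HasSum (fun Γ : Feynman.GenusGraph =>
      Feynman.contribution b B C k Γ / (Γ.nV.factorial * Γ.nH.factorial))
      ((Feynman.formalIntegral b B C : LaurentSeries ℝ).coeff k) := by
    rw [← Feynman.graphDataEquiv.hasSum_iff]
    -- Summability provides an unconditional sum; its value is then found by summing over N last.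
    have hsum := (Feynman.summable_contribution b B C h00 h01 h02 k).hasSum
    have hN := hsum.sigma fun N => Feynman.hasSum_graphData b B C hG k N
    have hval : HasSum (fun N : ℕ => (N.factorial : ℝ)⁻¹ *
        Feynman.gaussE b B hG (Feynman.interactionCoeff b C k N))
        ((Feynman.formalIntegral b B C : LaurentSeries ℝ).coeff k) := by
      rw [PowerSeries.coeff_coe]
      split_ifs with hk
      · simp only [Feynman.interactionCoeff_of_neg b C h00 h01 hk, map_zero, mul_zero]
        exact hasSum_zero
      · obtain ⟨n, rfl⟩ := Int.eq_ofNat_of_zero_le (not_lt.1 hk)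
        simp only [Feynman.interactionCoeff_of_nonneg b C h00 h01]
        rw [Int.natAbs_natCast, Feynman.formalIntegral, PowerSeries.coeff_mk]
        simp only [Feynman.coeff_integrand b B C h02]
        exact Feynman.hasSum_coeff_reducedInteraction b B C hG h02 n
    rw [← hN.unique hval]
    exact hsum
  have hinv : ∀ i j, (Feynman.gram b B)⁻¹ i j = (Feynman.gram b B)⁻¹ j i := fun i j => by
    have := hG.inv.isHermitian.apply j i
    simpa using this
  have hiso : ∀ Γ Δ : Feynman.GenusGraph, Feynman.GenusGraph.Iso Γ Δ →
      Feynman.contribution b B C k Δ = Feynman.contribution b B C k Γ := fun Γ Δ i => by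
    rw [Feynman.contribution, Feynman.contribution, i.eulerChar_eq,
      Feynman.amplitude_iso C b hinv i]
  have hclass := Feynman.GenusGraph.sigmaValencesEquiv.hasSum_iff.2
    (Feynman.GenusGraph.hasSum_graphClass hiso hlabelled)
  convert hclass using 1
  funext x
  change _ = Feynman.contribution b B C k x.2.1.rep / (Nat.card x.2.1.rep.Aut : ℝ)
  rw [Feynman.graphTerm, Feynman.contribution, HahnSeries.coeff_single]
  by_cases h : 2 * -x.2.1.rep.eulerChar = k
  · rw [if_pos h, if_pos h.symm, mul_div_assoc]
  · rw [if_neg h, if_neg (Ne.symm h), mul_zero, zero_div]
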